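/- Let $\Bbbk$ be a field, $0\neq v\in\Bbbk$, and $n\ge 0$ an integer. For $m\ge 0$ put $[m]=\sum_{j=0}^{m-1}v^{-(m-1)+2j}$, $[-m]=-[m]$, and $[m]!=[1][2]\cdots[m]$. For $n\in\mathbb Z$ let $X(n)=\{i\in\mathbb Z\cap[-n,n] : i\equiv n \pmod 2\}$ and $X(n)_+=\{m\in X(n): m\ge 0\}$. Let $S(n)$ be the associative unital $\Bbbk$-algebra with generators $E$, $F$, $1_i$ ($i\in X(n)$) and, with the convention $1_i=0$ for $i\notin X(n)$, relations $1_i1_j=\delta_{ij}1_i$, $\sum_{i}1_i=1$, $EF-FE=\sum_i[i]1_i$, $E1_i=1_{i+2}E$, $F1_i=1_{i-2}F$ for all $i\in\mathbb Z$ (so $S(n)=0$ if $n<0$). For $m\in X(n)_+$, let $V(m)=S(m)1_m$, regarded as a left $S(n)$-module through the algebra map $S(n)\to S(m)$ with $E\mapsto E$, $F\mapsto F$, and $1_i\mapsto 1_i$ for $i\in X(m)$, $1_i\mapsto 0$ otherwise. Assume $[n]!\neq 0$, and put $E^{(a)}=E^a/[a]!$, $F^{(a)}=F^a/[a]!$ for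 $0\le a\le n$. Then: (a) The elements $F^{(a)}1_nE^{(b)}$ ($0\le a,b\le n$) form a $\Bbbk$-basis of the two-sided ideal $S(n)1_nS(n)$. (b) The algebra map $S(n)\to S(n-2)$ with $E\mapsto E$, $F\mapsto F$, $1_i\mapsto 1_i$ if $|i|\le n-2$ and $1_i\mapsto 0$ if $|i|=n$ is surjective with kernel $S(n)1_nS(n)$; that is, there is an exact sequence $0\to S(n)1_nS(n)\to S(n)\to S(n-2)\to 0$, and $S(n)/(S(n)1_nS(n))\cong S(n-2)$ as algebras. (c) The algebra $S(n)$ is split semisimple over $\Bbbk$ (isomorphic to a finite direct product of full matrix algebras over $\Bbbk$), and $\{V(m): m\in X(n)_+\}$ is a complete set of pairwise non-isomorphic simple $S(n)$-modules, up to isomorphism. (d) The set $\bigsqcup_{m\in X(n)_+}\{F^{(a)}1_mE^{(b)} : 0\le a,b\le m\}$ is a $\Bbbk$-basis of $S(n)$. (e) $\dim_\Bbbk S(n)=\sum_{m\in X(n)_+}(m+1)^2=\binom{n+3}{3}$. -/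

import Mathlib

namespace QSchur

section Quantum

variable {k : Type*} [Field k]

/-- The balanced quantum integer `[n]` for a natural number `n`:
`[n] = ∑_{j=0}^{n-1} v^{-(n-1)+2j}`. -/
def qNat (v : k) (n : ℕ) : k :=
  ∑ j ∈ Finset.range n, v ^ (-((n : ℤ) - 1) + 2 * (j : ℤ))

/-- The quantum integer `[i]` for an arbitrary integer, with `[-i] = -[i]`. -/
def qInt (v : k) (i : ℤ) : k :=
  if 0 ≤ i then qNat v i.toNat else -qNat v (-i).toNat

/-- The quantum factorial `[n]! = [1][2]⋯[n]`. -/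
def qFactorial (v : k) (n : ℕ) : k :=
  ∏ j ∈ Finset.Icc 1 n, qNat v j

end Quantum

/-- `X(n)`: the integers in `[-n, n]` congruent to `n` modulo `2` (empty if `n < 0`). -/
noncomputable def X (n : ℤ) : Finset ℤ :=
  (Finset.Icc (-n) n).filter (fun i => i ≡ n [ZMOD 2])

/-- `X(n)_+`: the nonnegative elements of `X(n)`. -/
noncomputable def Xplus (n : ℤ) : Finset ℤ :=
  (X n).filter (fun m => 0 ≤ m)

theorem mem_X {n i : ℤ} : i ∈ X n ↔ (-n ≤ i ∧ i ≤ n) ∧ i % 2 = n % 2 := by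
  rw [X, Finset.mem_filter, Finset.mem_Icc, Int.ModEq]

theorem X_sub_two_subset (n : ℤ) : X (n - 2) ⊆ X n := by
  intro i hi
  rw [mem_X] at hi ⊢
  omega

theorem X_subset_of_mem {n m : ℤ} (hm : m ∈ Xplus n) : X m ⊆ X n := by
  intro i hi
  simp only [Xplus, Finset.mem_filter] at hm
  have h := hm.1
  rw [mem_X] at hi h ⊢
  omega

/-- The generators `E`, `F`, `1_i` (`i ∈ X(n)`). -/
inductive Gen (n : ℤ) : Type
  | E : Gen n
  | F : Gen n
  | idem (i : X n) : Gen n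

section Algebra

variable {k : Type*} [Field k]

/-- The generator `E` in the free algebra. -/
abbrev fE (k : Type*) [Field k] (n : ℤ) : FreeAlgebra k (Gen n) := FreeAlgebra.ι k Gen.E

/-- The generator `F` in the free algebra. -/
abbrev fF (k : Type*) [Field k] (n : ℤ) : FreeAlgebra k (Gen n) := FreeAlgebra.ι k Gen.F

/-- The generator `1_i` in the free algebra. -/
abbrev fIdem (k : Type*) [Field k] {n : ℤ} (i : X n) : FreeAlgebra k (Gen n) :=
  FreeAlgebra.ι k (Gen.idem i)

/-- The defining relations of the rank one quantum Schur algebra. -/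
inductive Rel (v : k) (n : ℤ) : FreeAlgebra k (Gen n) → FreeAlgebra k (Gen n) → Prop
  | idem_mul (i j : X n) : Rel v n (fIdem k i * fIdem k j) (if i = j then fIdem k i else 0)
  | idem_sum : Rel v n (∑ i : X n, fIdem k i) 1
  | comm : Rel v n (fE k n * fF k n - fF k n * fE k n) (∑ i : X n, qInt v i • fIdem k i)
  | E_idem (i : X n) (h : (i : ℤ) + 2 ∈ X n) :
      Rel v n (fE k n * fIdem k i) (fIdem k ⟨i + 2, h⟩ * fE k n)
  | E_idem_zero (i : X n) (h : (i : ℤ) + 2 ∉ X n) : Rel v n (fE k n * fIdem k i) 0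
  | F_idem (i : X n) (h : (i : ℤ) - 2 ∈ X n) :
      Rel v n (fF k n * fIdem k i) (fIdem k ⟨i - 2, h⟩ * fF k n)
  | F_idem_zero (i : X n) (h : (i : ℤ) - 2 ∉ X n) : Rel v n (fF k n * fIdem k i) 0
  | idem_E (i : X n) (h : (i : ℤ) - 2 ∈ X n) :
      Rel v n (fIdem k i * fE k n) (fE k n * fIdem k ⟨i - 2, h⟩)
  | idem_E_zero (i : X n) (h : (i : ℤ) - 2 ∉ X n) : Rel v n (fIdem k i * fE k n) 0
  | idem_F (i : X n) (h : (i : ℤ) + 2 ∈ X n) :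
      Rel v n (fIdem k i * fF k n) (fF k n * fIdem k ⟨i + 2, h⟩)
  | idem_F_zero (i : X n) (h : (i : ℤ) + 2 ∉ X n) : Rel v n (fIdem k i * fF k n) 0

/-- The rank one quantum Schur algebra `S(n)` at the parameter `v`. For `n < 0` there are no
idempotent generators, so `1 = 0` and this is the zero algebra. -/
def SchurAlg (v : k) (n : ℤ) : Type _ := RingQuot (Rel v n)

instance (v : k) (n : ℤ) : Ring (SchurAlg v n) := inferInstanceAs (Ring (RingQuot (Rel v n)))

instance (v : k) (n : ℤ) : Algebra k (SchurAlg v n) :=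
  inferInstanceAs (Algebra k (RingQuot (Rel v n)))

/-- The presentation map from the free algebra onto `S(n)`. -/
def mk (v : k) (n : ℤ) : FreeAlgebra k (Gen n) →ₐ[k] SchurAlg v n :=
  RingQuot.mkAlgHom k (Rel v n)

theorem mk_rel {v : k} {n : ℤ} {x y : FreeAlgebra k (Gen n)} (h : Rel v n x y) :
    mk v n x = mk v n y :=
  RingQuot.mkAlgHom_rel k h

/-- The element `E` of `S(n)`. -/
def E (v : k) (n : ℤ) : SchurAlg v n := mk v n (fE k n)

/-- The element `F` of `S(n)`. -/
def F (v : k) (n : ℤ) : SchurAlg v n := mk v n (fF k n)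

/-- The element `1_i` of `S(n)`, with the convention `1_i = 0` for `i ∉ X(n)`. -/
noncomputable def idem (v : k) (n i : ℤ) : SchurAlg v n :=
  if h : i ∈ X n then mk v n (fIdem k ⟨i, h⟩) else 0

theorem mk_fIdem (v : k) {n : ℤ} (i : X n) : mk v n (fIdem k i) = idem v n i := by
  simp [idem]

theorem idem_of_notMem (v : k) {n i : ℤ} (h : i ∉ X n) : idem v n i = 0 := by
  simp [idem, h]

theorem idem_mul_idem (v : k) (n i j : ℤ) :
    idem v n i * idem v n j = if i = j then idem v n i else 0 := by
  by_cases hi : i ∈ X n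
  · by_cases hj : j ∈ X n
    · have h := mk_rel (Rel.idem_mul (v := v) ⟨i, hi⟩ ⟨j, hj⟩)
      rw [map_mul, mk_fIdem, mk_fIdem] at h
      rw [h]
      by_cases hij : i = j
      · simp [hij, mk_fIdem]
      · simp [hij]
    · have hij : i ≠ j := fun h => hj (h ▸ hi)
      simp [idem_of_notMem v hj, hij]
  · simp [idem_of_notMem v hi]

theorem sum_idem (v : k) (n : ℤ) : ∑ i ∈ X n, idem v n i = 1 := by
  have h := mk_rel (Rel.idem_sum (v := v) (n := n))
  rw [map_sum, map_one] at h
  rw [← h, ← Finset.sum_coe_sort (X n)]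
  exact Finset.sum_congr rfl fun i _ => (mk_fIdem v i).symm

theorem E_mul_F (v : k) (n : ℤ) :
    E v n * F v n - F v n * E v n = ∑ i ∈ X n, qInt v i • idem v n i := by
  have h := mk_rel (Rel.comm (v := v) (n := n))
  rw [map_sub, map_mul, map_mul, map_sum] at h
  rw [E, F, h, ← Finset.sum_coe_sort (X n)]
  exact Finset.sum_congr rfl fun i _ => by rw [map_smul, mk_fIdem]

theorem E_mul_idem (v : k) (n i : ℤ) : E v n * idem v n i = idem v n (i + 2) * E v n := by
  by_cases hi : i ∈ X n
  · by_cases hj : i + 2 ∈ X n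
    · have h := mk_rel (Rel.E_idem (v := v) ⟨i, hi⟩ hj)
      rwa [map_mul, map_mul, mk_fIdem, mk_fIdem] at h
    · have h := mk_rel (Rel.E_idem_zero (v := v) ⟨i, hi⟩ hj)
      rw [map_mul, mk_fIdem, map_zero] at h
      rw [idem_of_notMem v hj, zero_mul]
      exact h
  · by_cases hj : i + 2 ∈ X n
    · have h := mk_rel (Rel.idem_E_zero (v := v) ⟨i + 2, hj⟩ (by simpa using hi))
      rw [map_mul, mk_fIdem, map_zero] at h
      rw [idem_of_notMem v hi, mul_zero]
      exact h.symm
    · simp [idem_of_notMem v hi, idem_of_notMem v hj]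

theorem F_mul_idem (v : k) (n i : ℤ) : F v n * idem v n i = idem v n (i - 2) * F v n := by
  by_cases hi : i ∈ X n
  · by_cases hj : i - 2 ∈ X n
    · have h := mk_rel (Rel.F_idem (v := v) ⟨i, hi⟩ hj)
      rwa [map_mul, map_mul, mk_fIdem, mk_fIdem] at h
    · have h := mk_rel (Rel.F_idem_zero (v := v) ⟨i, hi⟩ hj)
      rw [map_mul, mk_fIdem, map_zero] at h
      rw [idem_of_notMem v hj, zero_mul]
      exact h
  · by_cases hj : i - 2 ∈ X n
    · have h := mk_rel (Rel.idem_F_zero (v := v) ⟨i - 2, hj⟩ (by simpa using hi))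
      rw [map_mul, mk_fIdem, map_zero] at h
      rw [idem_of_notMem v hi, mul_zero]
      exact h.symm
    · simp [idem_of_notMem v hi, idem_of_notMem v hj]

/-- The images in `S(m)` of the generators of `S(n)`: `E ↦ E`, `F ↦ F`, and `1_i ↦ 1_i` if
`i ∈ X(m)`, `1_i ↦ 0` otherwise. -/
noncomputable def projGen (v : k) (n m : ℤ) : Gen n → SchurAlg v m
  | Gen.E => E v m
  | Gen.F => F v m
  | Gen.idem i => idem v m i

theorem projGen_rel (v : k) {n m : ℤ} (hX : X m ⊆ X n) {x y : FreeAlgebra k (Gen n)}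
    (h : Rel v n x y) :
    FreeAlgebra.lift k (projGen v n m) x = FreeAlgebra.lift k (projGen v n m) y := by
  induction h with
  | idem_mul i j =>
    rw [map_mul, apply_ite (FreeAlgebra.lift k (projGen v n m))]
    simp only [FreeAlgebra.lift_ι_apply, projGen, idem_mul_idem, map_zero, Subtype.ext_iff]
  | idem_sum =>
    rw [map_sum, map_one, ← sum_idem v m, Finset.sum_subset hX
      (fun i _ hi => idem_of_notMem v hi), ← Finset.sum_coe_sort (X n)]
    simp [projGen]
  | comm =>
    rw [map_sub, map_mul, map_mul, map_sum]
    simp only [FreeAlgebra.lift_ι_apply, projGen, map_smul]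
    rw [E_mul_F, Finset.sum_subset hX
      (fun i _ hi => by rw [idem_of_notMem v hi, smul_zero]), ← Finset.sum_coe_sort (X n)]
  | E_idem i h => simp [projGen, E_mul_idem]
  | E_idem_zero i h =>
    simp [projGen, E_mul_idem, idem_of_notMem v (fun hm => h (hX hm))]
  | F_idem i h => simp [projGen, F_mul_idem]
  | F_idem_zero i h =>
    simp [projGen, F_mul_idem, idem_of_notMem v (fun hm => h (hX hm))]
  | idem_E i h => simp [projGen, E_mul_idem]
  | idem_E_zero i h =>
    have := E_mul_idem v m ((i : ℤ) - 2)
    rw [idem_of_notMem v (fun hm => h (hX hm)), mul_zero, sub_add_cancel] at this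
    simp [projGen, ← this]
  | idem_F i h => simp [projGen, F_mul_idem]
  | idem_F_zero i h =>
    have := F_mul_idem v m ((i : ℤ) + 2)
    rw [idem_of_notMem v (fun hm => h (hX hm)), mul_zero, add_sub_cancel_right] at this
    simp [projGen, ← this]

/-- The algebra map `S(n) → S(m)` with `E ↦ E`, `F ↦ F`, `1_i ↦ 1_i` for `i ∈ X(m)` and
`1_i ↦ 0` for `i ∈ X(n) \ X(m)`. For `m = n - 2` it is the quotient map `φ_n`; for
`m ∈ X(n)_+` it is the composite `φ_{m+2} ⋯ φ_{n-2} φ_n` (see `proj_self`, `proj_comp`). -/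
noncomputable def proj (v : k) {n m : ℤ} (hX : X m ⊆ X n) : SchurAlg v n →ₐ[k] SchurAlg v m :=
  RingQuot.liftAlgHom k ⟨FreeAlgebra.lift k (projGen v n m), fun _ _ h => projGen_rel v hX h⟩

theorem proj_mk (v : k) {n m : ℤ} (hX : X m ⊆ X n) (x : FreeAlgebra k (Gen n)) :
    proj v hX (mk v n x) = FreeAlgebra.lift k (projGen v n m) x :=
  RingQuot.liftAlgHom_mkAlgHom_apply k _ _ x

theorem proj_E (v : k) {n m : ℤ} (hX : X m ⊆ X n) : proj v hX (E v n) = E v m := by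
  simp [E, proj_mk, projGen]

theorem proj_F (v : k) {n m : ℤ} (hX : X m ⊆ X n) : proj v hX (F v n) = F v m := by
  simp [F, proj_mk, projGen]

theorem proj_idem (v : k) {n m : ℤ} (hX : X m ⊆ X n) (i : ℤ) :
    proj v hX (idem v n i) = idem v m i := by
  by_cases hi : i ∈ X n
  · rw [← mk_fIdem v ⟨i, hi⟩, proj_mk]
    simp [projGen]
  · rw [idem_of_notMem v hi, idem_of_notMem v (fun hm => hi (hX hm)), map_zero]

theorem algHom_ext {v : k} {n : ℤ} {A : Type*} [Ring A] [Algebra k A]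
    {f g : SchurAlg v n →ₐ[k] A} (hE : f (E v n) = g (E v n)) (hF : f (F v n) = g (F v n))
    (hi : ∀ i, f (idem v n i) = g (idem v n i)) : f = g := by
  have h : f.comp (mk v n) = g.comp (mk v n) := by
    apply FreeAlgebra.hom_ext
    funext x
    cases x with
    | E => exact hE
    | F => exact hF
    | idem i =>
      have := hi i
      rw [← mk_fIdem] at this
      exact this
  exact RingQuot.ringQuot_ext' k f g h

theorem proj_self (v : k) (n : ℤ) : proj v (Finset.Subset.refl (X n)) = AlgHom.id k _ :=
  algHom_ext (by simp [proj_E]) (by simp [proj_F]) (by simp [proj_idem])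

theorem proj_comp (v : k) {n l m : ℤ} (h₁ : X l ⊆ X n) (h₂ : X m ⊆ X l) :
    (proj v h₂).comp (proj v h₁) = proj v (h₂.trans h₁) :=
  algHom_ext (by simp [proj_E]) (by simp [proj_F]) (by simp [proj_idem])

/-- The left `S(m)`-module `V(m) = S(m) 1_m`, for `m ∈ X(n)_+`, regarded below as a left
`S(n)`-module through `S(n) → S(m)`. -/
def V (v : k) (n : ℤ) (m : Xplus n) : Type _ :=
  ↥(Ideal.span {idem v (m : ℤ) (m : ℤ)} : Ideal (SchurAlg v (m : ℤ)))

noncomputable instance (v : k) (n : ℤ) (m : Xplus n) : AddCommGroup (V v n m) :=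
  inferInstanceAs (AddCommGroup
    ↥(Ideal.span {idem v (m : ℤ) (m : ℤ)} : Ideal (SchurAlg v (m : ℤ))))

noncomputable instance (v : k) (n : ℤ) (m : Xplus n) : Module (SchurAlg v n) (V v n m) :=
  Module.compHom ↥(Ideal.span {idem v (m : ℤ) (m : ℤ)} : Ideal (SchurAlg v (m : ℤ)))
    (proj v (X_subset_of_mem m.2)).toRingHom

/-- The divided power `E^{(a)} = E^a / [a]!`. -/
noncomputable def divE (v : k) (n : ℤ) (a : ℕ) : SchurAlg v n :=
  (qFactorial v a)⁻¹ • E v n ^ a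

/-- The divided power `F^{(a)} = F^a / [a]!`. -/
noncomputable def divF (v : k) (n : ℤ) (a : ℕ) : SchurAlg v n :=
  (qFactorial v a)⁻¹ • F v n ^ a

end Algebra

/-- A `k`-algebra is split semisimple if it is isomorphic to a finite direct product of full
matrix algebras over `k`. -/
def IsSplitSemisimple (k : Type*) [Field k] (A : Type*) [Ring A] [Algebra k A] : Prop :=
  ∃ (r : ℕ) (d : Fin r → ℕ), (∀ i, 0 < d i) ∧
    Nonempty (A ≃ₐ[k] ((i : Fin r) → Matrix (Fin (d i)) (Fin (d i)) k))

end QSchur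

/-! The argument bounds the size of $S(n)$ from both sides. For the upper bound, $1_n$ is a highest
weight idempotent: $E1_n=0$, $1_nF=0$, and $EF^{a+1}1_n=[a+1][n-a]F^a1_n$
(`E_mul_F_pow_mul_idem_self`, with a mirror image on the right). So the span of the
$F^{(a)}1_nE^{(b)}$ is closed under multiplication by generators on both sides, and is the ideal of
$1_n$ (`span_monomial_eq`). As $[n]!\neq0$, $F^n1_nE^n$ is a nonzero multiple of $1_{-n}$, so the
ideal contains $1_{-n}$ too. The quotient then satisfies the relations of $S(n-2)$, which identifies
the kernel of $S(n)\to S(n-2)$ (`ker_proj`). Descending in steps of two shows that the monomials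
span $S(n)$ (`span_monomialFamily`).

For the lower bound, each $m\in X(n)_+$ gives an explicit representation by matrices of size $m+1$.
There $F^{(a)}1_mE^{(b)}$ is a nonzero multiple of the matrix unit $e_{ab}$, while monomials through
a larger weight act as zero. This triangularity makes the monomials independent
(`linearIndependent_totalRep`). They number $\sum(m+1)^2$, the dimension of the product of the
matrix algebras, so $S(n)$ is that product (`totalRep_bijective`). The simple modules are then read
off from matrix units. -/

namespace QSchur

/-! ### Identities for quantum integers -/

section QuantumIntegers

variable {k : Type*} [Field k] {v : k}

theorem qNat_zero : qNat v 0 = 0 := by simp [qNat]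

theorem qNat_succ (hv : v ≠ 0) (a : ℕ) :
    qNat v (a + 1) = v * qNat v a + v ^ (-(a : ℤ)) := by
  rw [qNat, Finset.sum_range_succ', qNat, Finset.mul_sum]
  congr 1
  · refine Finset.sum_congr rfl fun j _ => ?_
    rw [← zpow_one_add₀ hv]
    congr 1
    push_cast
    ring
  · congr 1
    push_cast
    ring

theorem qNat_succ' (hv : v ≠ 0) (a : ℕ) :
    qNat v (a + 1) = v⁻¹ * qNat v a + v ^ (a : ℤ) := by
  rw [qNat, Finset.sum_range_succ, qNat, Finset.mul_sum]
  congr 1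
  · refine Finset.sum_congr rfl fun j _ => ?_
    rw [← zpow_neg_one, ← zpow_add₀ hv]
    congr 1
    push_cast
    ring
  · congr 1
    push_cast
    ring

theorem qInt_natCast (a : ℕ) : qInt v a = qNat v a := by simp [qInt]

theorem qInt_neg (i : ℤ) : qInt v (-i) = -qInt v i := by
  rcases lt_trichotomy i 0 with h | rfl | h
  · rw [qInt, qInt, if_pos (by lia), if_neg (by lia), neg_neg]
  · simp [qInt, qNat_zero]
  · rw [qInt, qInt, if_neg (by lia), if_pos (by lia), neg_neg]

theorem qInt_sub_one (hv : v ≠ 0) (i : ℤ) :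
    qInt v (i - 1) = v⁻¹ * qInt v i - v ^ (-i) := by
  have hz : v⁻¹ * v = 1 := inv_mul_cancel₀ hv
  rcases lt_or_ge 0 i with h | h
  · obtain ⟨a, rfl⟩ : ∃ a : ℕ, i = ((a + 1 : ℕ) : ℤ) := ⟨i.toNat - 1, by lia⟩
    have h1 : (((a + 1 : ℕ) : ℤ) - 1) = (a : ℤ) := by lia
    have h2 : v ^ (-(((a + 1 : ℕ) : ℤ))) = v⁻¹ * v ^ (-(a : ℤ)) := by
      rw [← zpow_neg_one, ← zpow_add₀ hv]
      congr 1
      push_cast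
      ring
    rw [h1, qInt_natCast, qInt_natCast, qNat_succ hv, h2]
    linear_combination -qNat v a * hz
  · obtain ⟨a, rfl⟩ : ∃ a : ℕ, i = -(a : ℤ) := ⟨(-i).toNat, by lia⟩
    have h1 : (-(a : ℤ) - 1) = -((a + 1 : ℕ) : ℤ) := by lia
    rw [h1, qInt_neg, qInt_neg, qInt_natCast, qInt_natCast, qNat_succ' hv, neg_neg]
    ring

theorem qInt_sub (hv : v ≠ 0) (b : ℤ) (a : ℕ) :
    qInt v (b - a) = v ^ (-(a : ℤ)) * qInt v b - v ^ (-b) * qNat v a := by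
  induction a with
  | zero => simp [qNat_zero]
  | succ a ih =>
    have h1 : b - ((a + 1 : ℕ) : ℤ) = (b - a) - 1 := by lia
    have h2 : v ^ (-(((a + 1 : ℕ) : ℤ))) = v⁻¹ * v ^ (-(a : ℤ)) := by
      rw [← zpow_neg_one, ← zpow_add₀ hv]
      congr 1
      push_cast
      ring
    have h3 : v ^ (-(b - a)) = v ^ (-b) * v ^ (a : ℤ) := by
      rw [← zpow_add₀ hv]
      congr 1
      ring
    rw [h1, qInt_sub_one hv, ih, qNat_succ' hv, h2, h3]
    ring

/-- The one quantum identity behind every commutation formula below. It is proved by recursion,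
without dividing by $v-v^{-1}$, so $v^2=1$ is allowed. -/
theorem qNat_mul_sub (hv : v ≠ 0) (a b : ℕ) :
    qNat v (a + 1) * qNat v b - qNat v (b + 1) * qNat v a = qInt v ((b : ℤ) - a) := by
  rw [qInt_sub hv, qNat_succ hv, qNat_succ hv, qInt_natCast]
  ring

theorem qFactorial_zero : qFactorial v 0 = 1 := by simp [qFactorial]

theorem qFactorial_succ (a : ℕ) :
    qFactorial v (a + 1) = qFactorial v a * qNat v (a + 1) := by
  rw [qFactorial, Finset.prod_Icc_succ_top (by lia), qFactorial]

theorem qNat_ne_zero {n a : ℕ} (hn : qFactorial v n ≠ 0) (h0 : 0 < a) (ha : a ≤ n) :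
    qNat v a ≠ 0 :=
  Finset.prod_ne_zero_iff.mp hn a (Finset.mem_Icc.mpr ⟨h0, ha⟩)

theorem qFactorial_ne_zero {n a : ℕ} (hn : qFactorial v n ≠ 0) (ha : a ≤ n) :
    qFactorial v a ≠ 0 :=
  Finset.prod_ne_zero_iff.mpr fun _ hj =>
    qNat_ne_zero hn (Finset.mem_Icc.mp hj).1 ((Finset.mem_Icc.mp hj).2.trans ha)

end QuantumIntegers

/-! ### Universal property and generators of $S(n)$ -/

section UniversalProperty

variable {k : Type*} [Field k]

/-- Elements of a `k`-algebra satisfying the defining relations of `S(n)`. -/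
structure IsSchurFamily (v : k) (n : ℤ) {A : Type*} [Ring A] [Algebra k A]
    (e f : A) (p : ℤ → A) : Prop where
  eq_zero : ∀ i ∉ X n, p i = 0
  mul : ∀ i j, p i * p j = if i = j then p i else 0
  sum : ∑ i ∈ X n, p i = 1
  comm : e * f - f * e = ∑ i ∈ X n, qInt v i • p i
  e_mul : ∀ i, e * p i = p (i + 2) * e
  f_mul : ∀ i, f * p i = p (i - 2) * f

variable {v : k} {n : ℤ} {A : Type*} [Ring A] [Algebra k A] {e f : A} {p : ℤ → A}

/-- The images of the generators of `S(n)` under the map attached to a Schur family. -/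
def IsSchurFamily.gen (_ : IsSchurFamily v n e f p) : Gen n → A
  | Gen.E => e
  | Gen.F => f
  | Gen.idem i => p i

theorem IsSchurFamily.gen_rel (h : IsSchurFamily v n e f p) {x y : FreeAlgebra k (Gen n)}
    (hr : Rel v n x y) : FreeAlgebra.lift k h.gen x = FreeAlgebra.lift k h.gen y := by
  induction hr with
  | idem_mul i j =>
    rw [map_mul, apply_ite (FreeAlgebra.lift k h.gen)]
    simp only [FreeAlgebra.lift_ι_apply, gen, h.mul, map_zero, Subtype.ext_iff]
  | idem_sum =>
    rw [map_sum, map_one, ← h.sum, ← Finset.sum_coe_sort (X n)]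
    simp [gen]
  | comm =>
    rw [map_sub, map_mul, map_mul, map_sum]
    simp only [FreeAlgebra.lift_ι_apply, gen, map_smul]
    rw [h.comm, ← Finset.sum_coe_sort (X n)]
  | E_idem i hi => simp [gen, h.e_mul]
  | E_idem_zero i hi => simp [gen, h.e_mul, h.eq_zero _ hi]
  | F_idem i hi => simp [gen, h.f_mul]
  | F_idem_zero i hi => simp [gen, h.f_mul, h.eq_zero _ hi]
  | idem_E i hi => simp [gen, h.e_mul]
  -- The relations with $1_i$ on the left are no separate axioms of a family: they are `e_mul` and
  -- `f_mul` read at a shifted weight.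
  | idem_E_zero i hi =>
    have := h.e_mul ((i : ℤ) - 2)
    rw [h.eq_zero _ hi, mul_zero, sub_add_cancel] at this
    simp [gen, ← this]
  | idem_F i hi => simp [gen, h.f_mul]
  | idem_F_zero i hi =>
    have := h.f_mul ((i : ℤ) + 2)
    rw [h.eq_zero _ hi, mul_zero, add_sub_cancel_right] at this
    simp [gen, ← this]

/-- The universal property of `S(n)`. -/
noncomputable def IsSchurFamily.lift (h : IsSchurFamily v n e f p) : SchurAlg v n →ₐ[k] A :=
  RingQuot.liftAlgHom k ⟨FreeAlgebra.lift k h.gen, fun _ _ hr => h.gen_rel hr⟩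

theorem IsSchurFamily.lift_mk (h : IsSchurFamily v n e f p) (x : FreeAlgebra k (Gen n)) :
    h.lift (QSchur.mk v n x) = FreeAlgebra.lift k h.gen x :=
  RingQuot.liftAlgHom_mkAlgHom_apply k _ _ x

theorem IsSchurFamily.lift_E (h : IsSchurFamily v n e f p) : h.lift (E v n) = e := by
  simp [E, h.lift_mk, gen]

theorem IsSchurFamily.lift_F (h : IsSchurFamily v n e f p) : h.lift (F v n) = f := by
  simp [F, h.lift_mk, gen]

theorem IsSchurFamily.lift_idem (h : IsSchurFamily v n e f p) (i : ℤ) :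
    h.lift (idem v n i) = p i := by
  by_cases hi : i ∈ X n
  · rw [← mk_fIdem v ⟨i, hi⟩, h.lift_mk]
    simp [gen]
  · rw [idem_of_notMem v hi, h.eq_zero i hi, map_zero]

theorem adjoin_eq_top (v : k) (n : ℤ) :
    Algebra.adjoin k ({E v n, F v n} ∪ Set.range (idem v n)) = ⊤ := by
  have hs : Function.Surjective (mk v n) := RingQuot.mkAlgHom_surjective k _
  have h : Algebra.adjoin k (mk v n '' Set.range (FreeAlgebra.ι k)) = ⊤ := by
    rw [← AlgHom.map_adjoin, FreeAlgebra.adjoin_range_ι, Algebra.map_top,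
      AlgHom.range_eq_top]
    exact hs
  refine top_unique (h ▸ Algebra.adjoin_mono ?_)
  rintro _ ⟨_, ⟨x, rfl⟩, rfl⟩
  cases x with
  | E => exact Or.inl (Or.inl rfl)
  | F => exact Or.inl (Or.inr rfl)
  | idem i => exact Or.inr ⟨i, (mk_fIdem v i).symm⟩

/-- To prove a property of all elements of `S(n)` it is enough to consider the generators. -/
theorem SchurAlg.induction {P : SchurAlg v n → Prop} (hE : P (E v n)) (hF : P (F v n))
    (hi : ∀ i, P (idem v n i)) (hc : ∀ c : k, P (algebraMap k _ c))
    (hadd : ∀ x y, P x → P y → P (x + y)) (hmul : ∀ x y, P x → P y → P (x * y))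
    (x : SchurAlg v n) : P x := by
  have hx : x ∈ Algebra.adjoin k ({E v n, F v n} ∪ Set.range (idem v n)) := by
    rw [adjoin_eq_top]; trivial
  induction hx using Algebra.adjoin_induction with
  | mem x hx =>
    rcases hx with (rfl | rfl) | ⟨i, rfl⟩
    exacts [hE, hF, hi i]
  | algebraMap r => exact hc r
  | add x y _ _ h1 h2 => exact hadd x y h1 h2
  | mul x y _ _ h1 h2 => exact hmul x y h1 h2

theorem proj_surjective (v : k) {n m : ℤ} (hX : X m ⊆ X n) :
    Function.Surjective (proj v hX) := by
  intro x
  induction x using SchurAlg.induction with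
  | hE => exact ⟨_, proj_E v hX⟩
  | hF => exact ⟨_, proj_F v hX⟩
  | hi i => exact ⟨_, proj_idem v hX i⟩
  | hc c => exact ⟨_, AlgHom.commutes _ c⟩
  | hadd x y h1 h2 =>
    obtain ⟨a, rfl⟩ := h1
    obtain ⟨b, rfl⟩ := h2
    exact ⟨a + b, map_add _ a b⟩
  | hmul x y h1 h2 =>
    obtain ⟨a, rfl⟩ := h1
    obtain ⟨b, rfl⟩ := h2
    exact ⟨a * b, map_mul _ a b⟩

end UniversalProperty

/-! ### Commutation with the extreme weight idempotents -/

section Commutation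

variable {k : Type*} [Field k] {v : k} {n : ℤ}

theorem E_pow_mul_idem (a : ℕ) (i : ℤ) :
    E v n ^ a * idem v n i = idem v n (i + 2 * a) * E v n ^ a := by
  induction a with
  | zero => simp
  | succ a ih =>
    rw [pow_succ', mul_assoc, ih, ← mul_assoc, E_mul_idem, mul_assoc]
    congr 2
    push_cast
    ring

theorem F_pow_mul_idem (a : ℕ) (i : ℤ) :
    F v n ^ a * idem v n i = idem v n (i - 2 * a) * F v n ^ a := by
  induction a with
  | zero => simp
  | succ a ih =>
    rw [pow_succ', mul_assoc, ih, ← mul_assoc, F_mul_idem, mul_assoc]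
    congr 2
    push_cast
    ring

theorem sum_smul_idem_mul_idem (i : ℤ) :
    (∑ j ∈ X n, qInt v j • idem v n j) * idem v n i = qInt v i • idem v n i := by
  rw [Finset.sum_mul]
  simp only [smul_mul_assoc, idem_mul_idem]
  by_cases hi : i ∈ X n
  · rw [Finset.sum_eq_single_of_mem i hi fun j _ hj => by rw [if_neg hj, smul_zero], if_pos rfl]
  · rw [idem_of_notMem v hi, smul_zero]
    exact Finset.sum_eq_zero fun j hj => by
      rw [if_neg (fun h : j = i => hi (h ▸ hj)), smul_zero]

theorem E_mul_F_mul_idem (i : ℤ) :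
    E v n * (F v n * idem v n i) =
      F v n * (E v n * idem v n i) + qInt v i • idem v n i := by
  rw [← sum_smul_idem_mul_idem, ← E_mul_F]
  noncomm_ring

theorem notMem_X_of_lt {n i : ℤ} (h : n < i) : i ∉ X n := by
  rw [mem_X]
  lia

theorem notMem_X_of_lt_neg {n i : ℤ} (h : i < -n) : i ∉ X n := by
  rw [mem_X]
  lia

variable {n : ℕ}

theorem E_mul_idem_self : E v n * idem v n n = 0 := by
  rw [E_mul_idem, idem_of_notMem v (notMem_X_of_lt (by lia)), zero_mul]

theorem F_mul_idem_neg_self : F v n * idem v n (-n) = 0 := by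
  rw [F_mul_idem, idem_of_notMem v (notMem_X_of_lt_neg (by lia)), zero_mul]

theorem idem_self_mul_F : idem v n n * F v n = 0 := by
  have h := F_mul_idem v n (n + 2)
  rw [add_sub_cancel_right] at h
  rw [← h, idem_of_notMem v (notMem_X_of_lt (by lia)), mul_zero]

theorem F_pow_mul_idem_self_eq_zero {a : ℕ} (ha : n < a) : F v n ^ a * idem v n n = 0 := by
  rw [F_pow_mul_idem, idem_of_notMem v (notMem_X_of_lt_neg (by lia)), zero_mul]

theorem idem_self_mul_E_pow_eq_zero {a : ℕ} (ha : n < a) : idem v n n * E v n ^ a = 0 := by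
  have h := E_pow_mul_idem (v := v) (n := n) a (n - 2 * a)
  rw [sub_add_cancel] at h
  rw [← h, idem_of_notMem v (notMem_X_of_lt_neg (by lia)), mul_zero]

/-- Moving $E$ past one more $F$ adds the weight $[n-2(a+1)]$ to the coefficient, and
$[a+1][n-a]+[n-2(a+1)]=[a+2][n-a-1]$ by `qNat_mul_sub`. -/
theorem E_mul_F_pow_mul_idem_self (hv : v ≠ 0) {a : ℕ} (ha : a ≤ n) :
    E v n * (F v n ^ (a + 1) * idem v n n) =
      (qNat v (a + 1) * qNat v (n - a)) • (F v n ^ a * idem v n n) := by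
  induction a with
  | zero =>
    rw [zero_add, pow_one, E_mul_F_mul_idem, E_mul_idem_self, mul_zero, zero_add, qInt_natCast]
    simp [qNat]
  | succ a ih =>
    have h := qNat_mul_sub hv (a + 1) (n - (a + 1))
    have h1 : n - (a + 1) + 1 = n - a := by lia
    have h2 : (((n - (a + 1) : ℕ) : ℤ) - (a + 1 : ℕ)) = (n : ℤ) - 2 * (a + 1 : ℕ) := by lia
    rw [h1, h2] at h
    rw [pow_succ' _ (a + 1), mul_assoc, F_pow_mul_idem, ← mul_assoc (F v n), ← mul_assoc (E v n),
      E_mul_F_mul_idem, add_mul, mul_assoc, mul_assoc, ← F_pow_mul_idem, ih (by lia),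
      smul_mul_assoc, ← F_pow_mul_idem, mul_smul_comm, ← mul_assoc, ← pow_succ', ← add_smul, ← h]
    congr 1
    ring

theorem idem_self_mul_E_pow_mul_F (hv : v ≠ 0) {a : ℕ} (ha : a ≤ n) :
    idem v n n * E v n ^ (a + 1) * F v n =
      (qNat v (a + 1) * qNat v (n - a)) • (idem v n n * E v n ^ a) := by
  -- Since $1_nE^b=E^b1_{n-2b}$, the commutator $EF-FE$ acts on the right of it as the scalar
  -- $[n-2b]$.
  have key : ∀ b : ℕ, idem v n n * E v n ^ b * (E v n * F v n) =
      idem v n n * E v n ^ b * (F v n * E v n) +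
        qInt v ((n : ℤ) - 2 * b) • (idem v n n * E v n ^ b) := by
    intro b
    have h := E_pow_mul_idem (v := v) (n := n) b (n - 2 * b)
    rw [sub_add_cancel] at h
    rw [← h, mul_assoc, mul_assoc, ← mul_smul_comm, ← mul_add]
    congr 1
    have h3 := E_mul_F_mul_idem (v := v) (n := n) ((n : ℤ) - 2 * b)
    have hE := E_mul_idem v n ((n : ℤ) - 2 * b - 2)
    have hF := F_mul_idem v n ((n : ℤ) - 2 * b + 2)
    rw [sub_add_cancel] at hE
    rw [add_sub_cancel_right] at hF
    rw [F_mul_idem, ← mul_assoc, hE, mul_assoc, E_mul_idem, ← mul_assoc (F v n), hF,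
      mul_assoc] at h3
    exact h3
  induction a with
  | zero =>
    have h := key 0
    simp only [pow_zero, mul_one, ← mul_assoc, idem_self_mul_F, zero_mul, zero_add] at h
    rw [zero_add, pow_one, h]
    simp [qNat, qInt_natCast]
  | succ a ih =>
    have h := qNat_mul_sub hv (a + 1) (n - (a + 1))
    have h1 : n - (a + 1) + 1 = n - a := by lia
    have h2 : (((n - (a + 1) : ℕ) : ℤ) - (a + 1 : ℕ)) = (n : ℤ) - 2 * (a + 1 : ℕ) := by lia
    rw [h1, h2] at h
    rw [pow_succ _ (a + 1), ← mul_assoc, mul_assoc, key, ← mul_assoc, ih (by lia),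
      smul_mul_assoc, mul_assoc, ← pow_succ, ← add_smul, ← h]
    congr 1
    ring

theorem F_mul_E_pow_mul_idem_neg_self (hv : v ≠ 0) {a : ℕ} (ha : a ≤ n) :
    F v n * (E v n ^ (a + 1) * idem v n (-n)) =
      (qNat v (a + 1) * qNat v (n - a)) • (E v n ^ a * idem v n (-n)) := by
  have key (i : ℤ) : F v n * (E v n * idem v n i) =
      E v n * (F v n * idem v n i) - qInt v i • idem v n i := by
    rw [E_mul_F_mul_idem, add_sub_cancel_right]
  induction a with
  | zero =>
    rw [zero_add, pow_one, key, F_mul_idem_neg_self, mul_zero, zero_sub, qInt_neg, qInt_natCast]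
    simp [qNat]
  | succ a ih =>
    have h := qNat_mul_sub hv (a + 1) (n - (a + 1))
    have h1 : n - (a + 1) + 1 = n - a := by lia
    have h2 : (((n - (a + 1) : ℕ) : ℤ) - (a + 1 : ℕ)) = -(-(n : ℤ) + 2 * (a + 1 : ℕ)) := by lia
    rw [h1, h2, qInt_neg] at h
    rw [pow_succ' _ (a + 1), mul_assoc, E_pow_mul_idem, ← mul_assoc (E v n), ← mul_assoc (F v n),
      key, sub_mul, mul_assoc, mul_assoc, ← E_pow_mul_idem, ih (by lia),
      smul_mul_assoc, ← E_pow_mul_idem, mul_smul_comm, ← mul_assoc, ← pow_succ', ← sub_smul]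
    congr 1
    linear_combination -h

/-- Up to an invertible scalar, `1_{-n}` is `F^n 1_n E^n`. -/
theorem F_pow_mul_idem_self_mul_E_pow (hv : v ≠ 0) (hn : qFactorial v n ≠ 0) :
    ∃ c : k, c ≠ 0 ∧
      F v n ^ n * idem v n n * E v n ^ n = c • idem v n (-n) := by
  -- Cancel one pair $F$, $E$ at a time; each step contributes $[a+1][n-a]$, whose two factors
  -- divide $[n]!$.
  have h : ∀ a ≤ n, ∃ c : k, c ≠ 0 ∧
      F v n ^ a * (E v n ^ a * idem v n (-n)) = c • idem v n (-n) := by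
    intro a
    induction a with
    | zero => exact fun _ => ⟨1, one_ne_zero, by simp⟩
    | succ a ih =>
      intro ha
      obtain ⟨c, hc, h⟩ := ih (by lia)
      refine ⟨qNat v (a + 1) * qNat v (n - a) * c, mul_ne_zero (mul_ne_zero
        (qNat_ne_zero hn (by lia) ha) (qNat_ne_zero hn (by lia) (by lia))) hc, ?_⟩
      rw [pow_succ (F v n), mul_assoc, F_mul_E_pow_mul_idem_neg_self hv (by lia), mul_smul_comm, h,
        smul_smul]
  obtain ⟨c, hc, h⟩ := h n le_rfl
  refine ⟨c, hc, ?_⟩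
  have h' := E_pow_mul_idem (v := v) (n := n) n (-n)
  rw [show -(n : ℤ) + 2 * (n : ℕ) = n by lia] at h'
  rw [← h, h', mul_assoc]

end Commutation

/-! ### The ideal generated by $1_n$ and the quotient $S(n-2)$ -/

section HighestWeightIdeal

variable {k : Type*} [Field k] {v : k}

/-- The element `F^{(a)} 1_m E^{(b)}` of `S(n)`. -/
noncomputable def monomial (v : k) (n m : ℤ) (a b : ℕ) : SchurAlg v n :=
  divF v n a * idem v n m * divE v n b

theorem monomial_eq_smul (n m : ℤ) (a b : ℕ) :
    monomial v n m a b =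
      ((qFactorial v a)⁻¹ * (qFactorial v b)⁻¹) • (F v n ^ a * idem v n m * E v n ^ b) := by
  rw [monomial, divF, divE, smul_mul_assoc, smul_mul_assoc, mul_smul_comm, smul_smul]

theorem proj_monomial {n l : ℤ} (hX : X l ⊆ X n) (m : ℤ) (a b : ℕ) :
    proj v hX (monomial v n m a b) = monomial v l m a b := by
  rw [monomial_eq_smul, monomial_eq_smul, map_smul, map_mul, map_mul, map_pow, map_pow, proj_E,
    proj_F, proj_idem]

variable {n : ℕ}

/-- Exponents above $n$ leave the weight range and give zero; otherwise the factorials are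
invertible. Allowing all exponents spares the closure proofs any bound on $a$ and $b$. -/
theorem pow_mul_pow_mem_span (hn : qFactorial v n ≠ 0) (a b : ℕ) :
    F v n ^ a * idem v n n * E v n ^ b ∈
      Submodule.span k (Set.range fun p : Fin (n + 1) × Fin (n + 1) =>
        monomial v n n p.1 p.2) := by
  rcases lt_or_ge n a with ha | ha
  · rw [F_pow_mul_idem_self_eq_zero ha, zero_mul]
    exact zero_mem _
  rcases lt_or_ge n b with hb | hb
  · rw [mul_assoc, idem_self_mul_E_pow_eq_zero hb, mul_zero]
    exact zero_mem _
  have h : F v n ^ a * idem v n n * E v n ^ b =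
      (qFactorial v a * qFactorial v b) • monomial v n n a b := by
    rw [monomial_eq_smul, smul_smul, ← mul_inv, mul_inv_cancel₀ (mul_ne_zero
      (qFactorial_ne_zero hn ha) (qFactorial_ne_zero hn hb)), one_smul]
  rw [h]
  exact Submodule.smul_mem _ _ (Submodule.subset_span
    ⟨(⟨a, Nat.lt_succ_of_le ha⟩, ⟨b, Nat.lt_succ_of_le hb⟩), rfl⟩)

theorem mul_mem_span_of_forall (s t : SchurAlg v n)
    (h : ∀ a b : ℕ, s * (F v n ^ a * idem v n n * E v n ^ b) * t ∈
      Submodule.span k (Set.range fun p : Fin (n + 1) × Fin (n + 1) => monomial v n n p.1 p.2))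
    {w : SchurAlg v n}
    (hw : w ∈ Submodule.span k (Set.range fun p : Fin (n + 1) × Fin (n + 1) =>
      monomial v n n p.1 p.2)) :
    s * w * t ∈ Submodule.span k (Set.range fun p : Fin (n + 1) × Fin (n + 1) =>
      monomial v n n p.1 p.2) := by
  induction hw using Submodule.span_induction with
  | mem x hx =>
    obtain ⟨p, rfl⟩ := hx
    simp only [monomial_eq_smul, mul_smul_comm, smul_mul_assoc] at h ⊢
    exact Submodule.smul_mem _ _ (h _ _)
  | zero => simp
  | add x y _ _ hx hy =>
    rw [mul_add, add_mul]
    exact add_mem hx hy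
  | smul c x _ hx =>
    rw [mul_smul_comm, smul_mul_assoc]
    exact Submodule.smul_mem _ _ hx

theorem mul_mem_span_left (hv : v ≠ 0) (hn : qFactorial v n ≠ 0) (s : SchurAlg v n) :
    ∀ {w : SchurAlg v n},
    w ∈ Submodule.span k (Set.range fun p : Fin (n + 1) × Fin (n + 1) => monomial v n n p.1 p.2) →
    s * w ∈ Submodule.span k (Set.range fun p : Fin (n + 1) × Fin (n + 1) =>
      monomial v n n p.1 p.2) := by
  induction s using SchurAlg.induction with
  | hE =>
    intro w hw
    rw [← mul_one (E v n * w)]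
    refine mul_mem_span_of_forall _ _ (fun a b => ?_) hw
    rw [mul_one, ← mul_assoc]
    rcases a with _ | a
    · rw [pow_zero, one_mul, E_mul_idem_self, zero_mul]
      exact zero_mem _
    rcases lt_or_ge n a with ha | ha
    · rw [F_pow_mul_idem_self_eq_zero (by lia), mul_zero, zero_mul]
      exact zero_mem _
    · rw [E_mul_F_pow_mul_idem_self hv ha, smul_mul_assoc]
      exact Submodule.smul_mem _ _ (pow_mul_pow_mem_span hn a b)
  | hF =>
    intro w hw
    rw [← mul_one (F v n * w)]
    refine mul_mem_span_of_forall _ _ (fun a b => ?_) hw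
    rw [mul_one, ← mul_assoc, ← mul_assoc, ← pow_succ']
    exact pow_mul_pow_mem_span hn (a + 1) b
  | hi i =>
    intro w hw
    rw [← mul_one (idem v n i * w)]
    refine mul_mem_span_of_forall _ _ (fun a b => ?_) hw
    rw [mul_one, F_pow_mul_idem, ← mul_assoc, ← mul_assoc, idem_mul_idem]
    split_ifs with h
    · rw [h, ← F_pow_mul_idem]
      exact pow_mul_pow_mem_span hn a b
    · rw [zero_mul, zero_mul]
      exact zero_mem _
  | hc c =>
    intro w hw
    rw [← Algebra.smul_def]
    exact Submodule.smul_mem _ _ hw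
  | hadd x y hx hy =>
    intro w hw
    rw [add_mul]
    exact add_mem (hx hw) (hy hw)
  | hmul x y hx hy =>
    intro w hw
    rw [mul_assoc]
    exact hx (hy hw)

theorem mul_mem_span_right (hv : v ≠ 0) (hn : qFactorial v n ≠ 0) (s : SchurAlg v n) :
    ∀ {w : SchurAlg v n},
    w ∈ Submodule.span k (Set.range fun p : Fin (n + 1) × Fin (n + 1) => monomial v n n p.1 p.2) →
    w * s ∈ Submodule.span k (Set.range fun p : Fin (n + 1) × Fin (n + 1) =>
      monomial v n n p.1 p.2) := by
  induction s using SchurAlg.induction with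
  | hE =>
    intro w hw
    rw [← one_mul w]
    refine mul_mem_span_of_forall _ _ (fun a b => ?_) hw
    rw [one_mul, mul_assoc, ← pow_succ]
    exact pow_mul_pow_mem_span hn a (b + 1)
  | hF =>
    intro w hw
    rw [← one_mul w]
    refine mul_mem_span_of_forall _ _ (fun a b => ?_) hw
    rw [one_mul, mul_assoc, mul_assoc, ← mul_assoc (idem v n n)]
    rcases b with _ | b
    · rw [pow_zero, mul_one, idem_self_mul_F, mul_zero]
      exact zero_mem _
    rcases lt_or_ge n b with hb | hb
    · rw [idem_self_mul_E_pow_eq_zero (by lia), zero_mul, mul_zero]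
      exact zero_mem _
    · rw [idem_self_mul_E_pow_mul_F hv hb, mul_smul_comm, ← mul_assoc]
      exact Submodule.smul_mem _ _ (pow_mul_pow_mem_span hn a b)
  | hi i =>
    intro w hw
    rw [← one_mul w]
    refine mul_mem_span_of_forall _ _ (fun a b => ?_) hw
    rw [one_mul, mul_assoc, E_pow_mul_idem, mul_assoc, ← mul_assoc (idem v n n), idem_mul_idem]
    split_ifs with h
    · rw [← mul_assoc]
      exact pow_mul_pow_mem_span hn a b
    · rw [zero_mul, mul_zero]
      exact zero_mem _
  | hc c =>
    intro w hw
    rw [← Algebra.commutes, ← Algebra.smul_def]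
    exact Submodule.smul_mem _ _ hw
  | hadd x y hx hy =>
    intro w hw
    rw [mul_add]
    exact add_mem (hx hw) (hy hw)
  | hmul x y hx hy =>
    intro w hw
    rw [← mul_assoc]
    exact hy (hx hw)

/-- Each monomial has $1_n$ as a factor. Conversely the span is itself a two-sided ideal, and it
contains $1_n$ as the case $a=b=0$. -/
theorem span_monomial_eq (hv : v ≠ 0) (hn : qFactorial v n ≠ 0) :
    (Submodule.span k (Set.range fun p : Fin (n + 1) × Fin (n + 1) =>
      monomial v n n p.1 p.2) : Set (SchurAlg v n)) = TwoSidedIdeal.span {idem v (n : ℤ) n} := by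
  have h1 : idem v (n : ℤ) n ∈ TwoSidedIdeal.span {idem v (n : ℤ) n} :=
    TwoSidedIdeal.subset_span rfl
  apply Set.Subset.antisymm
  · intro x hx
    induction hx using Submodule.span_induction with
    | mem x hx =>
      obtain ⟨p, rfl⟩ := hx
      exact TwoSidedIdeal.mul_mem_right _ _ _ (TwoSidedIdeal.mul_mem_left _ _ _ h1)
    | zero => exact zero_mem _
    | add x y _ _ hx hy => exact add_mem hx hy
    | smul c x _ hx =>
      rw [Algebra.smul_def]
      exact TwoSidedIdeal.mul_mem_left _ _ _ hx
  · let I : TwoSidedIdeal (SchurAlg v n) := TwoSidedIdeal.mk'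
      (Submodule.span k (Set.range fun p : Fin (n + 1) × Fin (n + 1) => monomial v n n p.1 p.2))
      (zero_mem _) (fun hx hy => add_mem hx hy) (fun hx => neg_mem hx)
      (fun {x _} hy => mul_mem_span_left hv hn x hy) (fun {_ y} hx => mul_mem_span_right hv hn y hx)
    have hI : TwoSidedIdeal.span {idem v (n : ℤ) n} ≤ I := by
      rw [TwoSidedIdeal.span_le, Set.singleton_subset_iff, SetLike.mem_coe, TwoSidedIdeal.mem_mk']
      simpa using! pow_mul_pow_mem_span hn 0 0
    intro x hx
    exact (TwoSidedIdeal.mem_mk' _ _ _ _ _ _ x).mp (hI hx)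

theorem idem_neg_self_mem (hv : v ≠ 0) (hn : qFactorial v n ≠ 0) :
    idem v n (-n) ∈ TwoSidedIdeal.span {idem v (n : ℤ) n} := by
  obtain ⟨c, hc, h⟩ := F_pow_mul_idem_self_mul_E_pow hv hn
  rw [← inv_smul_smul₀ hc (idem v n (-n)), ← h, Algebra.smul_def]
  exact TwoSidedIdeal.mul_mem_left _ _ _ (TwoSidedIdeal.mul_mem_right _ _ _
    (TwoSidedIdeal.mul_mem_left _ _ _ (TwoSidedIdeal.subset_span rfl)))

/-- The quotient map `S(n) → S(n) / S(n) 1_n S(n)`. -/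
noncomputable def quotMap (v : k) (n : ℕ) :
    SchurAlg v n →ₐ[k] (TwoSidedIdeal.span {idem v (n : ℤ) n}).ringCon.Quotient :=
  RingCon.mkₐ k _

theorem quotMap_eq_zero_iff {x : SchurAlg v n} :
    quotMap v n x = 0 ↔ x ∈ TwoSidedIdeal.span {idem v (n : ℤ) n} := by
  rw [TwoSidedIdeal.mem_iff]
  exact RingCon.eq _

theorem isSchurFamily_quotMap (hv : v ≠ 0) (hn : qFactorial v n ≠ 0) :
    IsSchurFamily v ((n : ℤ) - 2) (quotMap v n (E v n)) (quotMap v n (F v n))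
      (fun i => quotMap v n (idem v n i)) := by
  have h0 : ∀ i ∉ X ((n : ℤ) - 2), quotMap v n (idem v n i) = 0 := by
    intro i hi
    rw [quotMap_eq_zero_iff]
    -- The only weights of $X(n)$ outside $X(n-2)$ are $\pm n$.
    by_cases h : i ∈ X n
    · rcases eq_or_ne i n with rfl | h1
      · exact TwoSidedIdeal.subset_span rfl
      · have h2 : i = -n := by
          rw [mem_X] at h hi
          lia
        rw [h2]
        exact idem_neg_self_mem hv hn
    · rw [idem_of_notMem v h]
      exact zero_mem _
  refine ⟨h0, fun i j => ?_, ?_, ?_, fun i => ?_, fun i => ?_⟩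
  · rw [← map_mul, idem_mul_idem, apply_ite (quotMap v n), map_zero]
  · rw [Finset.sum_subset (X_sub_two_subset n) fun i _ hi => h0 i hi, ← map_sum, sum_idem, map_one]
  · rw [Finset.sum_subset (X_sub_two_subset n) fun i _ hi => by rw [h0 i hi, smul_zero]]
    simp only [← map_smul, ← map_mul, ← map_sub, ← map_sum]
    rw [E_mul_F]
  · rw [← map_mul, ← map_mul, E_mul_idem]
  · rw [← map_mul, ← map_mul, F_mul_idem]

/-- The quotient map factors through $S(n)\to S(n-2)$, so the kernel of the latter is no larger than
the ideal of $1_n$. -/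
theorem lift_comp_proj (hv : v ≠ 0) (hn : qFactorial v n ≠ 0) :
    (isSchurFamily_quotMap hv hn).lift.comp (proj v (X_sub_two_subset n)) = quotMap v n := by
  apply algHom_ext
  · rw [AlgHom.comp_apply, proj_E, IsSchurFamily.lift_E]
  · rw [AlgHom.comp_apply, proj_F, IsSchurFamily.lift_F]
  · intro i
    rw [AlgHom.comp_apply, proj_idem, IsSchurFamily.lift_idem]

theorem ker_proj (hv : v ≠ 0) (hn : qFactorial v n ≠ 0) :
    TwoSidedIdeal.ker (proj v (X_sub_two_subset n)) = TwoSidedIdeal.span {idem v (n : ℤ) n} := by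
  apply le_antisymm
  · intro x hx
    rw [TwoSidedIdeal.mem_ker] at hx
    rw [← quotMap_eq_zero_iff, ← lift_comp_proj hv hn, AlgHom.comp_apply, hx, map_zero]
  · rw [TwoSidedIdeal.span_le, Set.singleton_subset_iff, SetLike.mem_coe, TwoSidedIdeal.mem_ker,
      proj_idem, idem_of_notMem v (notMem_X_of_lt (by lia))]

theorem exists_quotient_algEquiv (hv : v ≠ 0) (hn : qFactorial v n ≠ 0) :
    ∃ e : (TwoSidedIdeal.span {idem v (n : ℤ) n}).ringCon.Quotient ≃ₐ[k] SchurAlg v ((n : ℤ) - 2),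
      ∀ x : SchurAlg v n,
        e (x : (TwoSidedIdeal.span {idem v (n : ℤ) n}).ringCon.Quotient) =
          proj v (X_sub_two_subset n) x := by
  have hc := lift_comp_proj hv hn
  have hsurj := proj_surjective v (X_sub_two_subset n)
  let g := (isSchurFamily_quotMap hv hn).lift
  have hg : ∀ x, g (proj v (X_sub_two_subset n) x) = quotMap v n x := fun x =>
    DFunLike.congr_fun hc x
  have hb : Function.Bijective g := by
    constructor
    · rw [injective_iff_map_eq_zero]
      intro y hy
      obtain ⟨x, rfl⟩ := hsurj y
      rw [hg, quotMap_eq_zero_iff, ← ker_proj hv hn, TwoSidedIdeal.mem_ker] at hy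
      exact hy
    · intro y
      obtain ⟨x, rfl⟩ := RingCon.mkₐ_surjective (α := k) _ y
      exact ⟨_, hg x⟩
  refine ⟨(AlgEquiv.ofBijective g hb).symm, fun x => ?_⟩
  rw [AlgEquiv.symm_apply_eq]
  exact (hg x).symm

end HighestWeightIdeal

/-! ### The monomials span $S(n)$ -/

section Spanning

variable {k : Type*} [Field k] {v : k}

theorem mem_Xplus {n m : ℤ} : m ∈ Xplus n ↔ (m ≤ n ∧ 0 ≤ m) ∧ m % 2 = n % 2 := by
  rw [Xplus, Finset.mem_filter, mem_X]
  lia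

theorem subsingleton_of_neg {n : ℤ} (h : n < 0) : Subsingleton (SchurAlg v n) := by
  have h1 : X n = ∅ := Finset.eq_empty_of_forall_notMem fun i hi => by
    rw [mem_X] at hi
    lia
  have h2 := sum_idem v n
  rw [h1, Finset.sum_empty] at h2
  exact subsingleton_of_zero_eq_one h2

/-- The elements `F^{(a)} 1_m E^{(b)}`, `0 ≤ a, b ≤ m`, indexed by a sigma type. -/
noncomputable def monomialFamily (v : k) (n : ℤ)
    (s : (m : Xplus n) × Fin ((m : ℤ).toNat + 1) × Fin ((m : ℤ).toNat + 1)) : SchurAlg v n :=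
  monomial v n s.1 s.2.1 s.2.2

/-- Recursion $n\mapsto n-2$ over the integers, so that the zero algebra at negative $n$ is the only
base case. Monomials of $S(n-2)$ lift to monomials of the same shape, and the error lies in the
ideal of $1_n$. -/
theorem span_monomialFamily (hv : v ≠ 0) (n : ℤ) (hn : qFactorial v n.toNat ≠ 0) :
    Submodule.span k (Set.range (monomialFamily v n)) = ⊤ := by
  rcases lt_or_ge n 0 with h | h
  · have := subsingleton_of_neg (v := v) h
    exact Subsingleton.elim _ _
  obtain ⟨N, rfl⟩ := Int.eq_ofNat_of_zero_le h
  rw [Int.toNat_natCast] at hn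
  have ih := span_monomialFamily hv ((N : ℤ) - 2) (qFactorial_ne_zero hn (by lia))
  have h1 : Submodule.span k (Set.range (monomialFamily v ((N : ℤ) - 2))) ≤
      (Submodule.span k (Set.range (monomialFamily v N))).map
        (proj v (X_sub_two_subset N)).toLinearMap := by
    rw [Submodule.span_le]
    rintro _ ⟨⟨⟨m, hm⟩, a, b⟩, rfl⟩
    have hm' : m ∈ Xplus (N : ℤ) := by
      rw [mem_Xplus] at hm ⊢
      lia
    exact ⟨monomialFamily v N ⟨⟨m, hm'⟩, a, b⟩, Submodule.subset_span ⟨_, rfl⟩,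
      proj_monomial (X_sub_two_subset N) m a b⟩
  have h2 : Submodule.span k (Set.range fun p : Fin (N + 1) × Fin (N + 1) =>
      monomial v N N p.1 p.2) ≤ Submodule.span k (Set.range (monomialFamily v N)) := by
    rw [Submodule.span_le]
    rintro _ ⟨p, rfl⟩
    have hm : (N : ℤ) ∈ Xplus (N : ℤ) := by
      rw [mem_Xplus]
      lia
    exact Submodule.subset_span ⟨⟨⟨N, hm⟩, p⟩, rfl⟩
  rw [ih] at h1
  refine top_unique fun x _ => ?_
  obtain ⟨y, hy, hxy⟩ := h1 (Submodule.mem_top (x := proj v (X_sub_two_subset N) x))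
  have h3 : x - y ∈ TwoSidedIdeal.span {idem v (N : ℤ) N} := by
    rw [← ker_proj hv hn, TwoSidedIdeal.mem_ker, map_sub, sub_eq_zero]
    exact hxy.symm
  rw [← SetLike.mem_coe, ← span_monomial_eq hv hn] at h3
  rw [← sub_add_cancel x y]
  exact add_mem (h2 h3) hy
-- The shift by one makes the measure drop at $n=0$ as well.
termination_by (n + 1).toNat
decreasing_by lia

end Spanning

/-! ### Matrix representations, independence of the monomials, dimension -/

section Representation

variable {k : Type*} [Field k]

/-- The matrix of `E` on the simple module of highest weight `m`. -/
def matE (v : k) (m : ℕ) : Matrix (Fin (m + 1)) (Fin (m + 1)) k :=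
  Matrix.of fun i j => if (j : ℕ) = i + 1 then qNat v (m - i) else 0

/-- The matrix of `F` on the simple module of highest weight `m`. -/
def matF (v : k) (m : ℕ) : Matrix (Fin (m + 1)) (Fin (m + 1)) k :=
  Matrix.of fun i j => if (i : ℕ) = j + 1 then qNat v i else 0

/-- The matrix of the projection onto the weight space of weight `i` in the simple module of
highest weight `m`. -/
def matIdem (k : Type*) [Field k] (m : ℕ) (i : ℤ) : Matrix (Fin (m + 1)) (Fin (m + 1)) k :=
  Matrix.diagonal fun a => if (m : ℤ) - 2 * (a : ℕ) = i then 1 else 0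

variable {v : k}

theorem matE_mul_matF (m : ℕ) :
    matE v m * matF v m = Matrix.diagonal fun i : Fin (m + 1) => qNat v (m - i) * qNat v (i + 1) := by
  ext i j
  rw [Matrix.mul_apply, Matrix.diagonal_apply]
  rcases eq_or_lt_of_le (Nat.le_of_lt_succ i.2) with hi | hi
  -- In the last row no intermediate index exists, and the formula survives because $[0]=0$.
  · rw [Finset.sum_eq_zero, hi, Nat.sub_self, qNat_zero, zero_mul, ite_self]
    intro l _
    have : (l : ℕ) ≠ i + 1 := by lia
    simp [matE, this]
  · rw [Finset.sum_eq_single ⟨i + 1, by lia⟩]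
    · by_cases hij : i = j
      · simp [matE, matF, hij]
      · have : (i : ℕ) ≠ j := fun h => hij (Fin.ext h)
        simp [matE, matF, hij, this]
    · intro l _ hl
      have : (l : ℕ) ≠ i + 1 := fun h => hl (Fin.ext h)
      simp [matE, this]
    · simp

theorem matF_mul_matE (m : ℕ) :
    matF v m * matE v m = Matrix.diagonal fun i : Fin (m + 1) => qNat v i * qNat v (m - i + 1) := by
  ext i j
  rw [Matrix.mul_apply, Matrix.diagonal_apply]
  rcases Nat.eq_zero_or_pos i with hi | hi
  · rw [Finset.sum_eq_zero, hi, qNat_zero, zero_mul, ite_self]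
    intro l _
    simp [matF, hi]
  · rw [Finset.sum_eq_single ⟨i - 1, by lia⟩]
    · have h1 : (i : ℕ) - 1 + 1 = i := by lia
      have h2 : m - ((i : ℕ) - 1) = m - i + 1 := by lia
      by_cases hij : i = j
      · subst hij
        simp [matE, matF, h1, h2]
      · have : (j : ℕ) ≠ i := fun h => hij (Fin.ext h.symm)
        simp [matE, matF, hij, this, h1]
    · intro l _ hl
      have : (i : ℕ) ≠ l + 1 := fun h => hl (Fin.ext (by simp [h]))
      simp [matF, this]
    · simp

/-- The basis vector with index $a$ plays the role of $F^{(a)}$ applied to a highest weight vector,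
and has weight $m-2a$. The commutator relation becomes $[m-a][a+1]-[a][m-a+1]=[m-2a]$. -/
theorem isSchurFamily_mat (hv : v ≠ 0) {n : ℤ} {m : ℕ} (hm : (m : ℤ) ∈ X n) :
    IsSchurFamily v n (matE v m) (matF v m) (matIdem k m) := by
  have hX : ∀ a : Fin (m + 1), (m : ℤ) - 2 * (a : ℕ) ∈ X n := by
    intro a
    have := a.2
    rw [mem_X] at hm ⊢
    lia
  refine ⟨fun i hi => ?_, fun i j => ?_, ?_, ?_, fun i => ?_, fun i => ?_⟩
  · rw [matIdem, ← Matrix.diagonal_zero]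
    congr 1
    funext a
    exact if_neg fun h : _ = i => hi (h ▸ hX a)
  · rw [matIdem, matIdem, Matrix.diagonal_mul_diagonal]
    split_ifs with h
    · subst h
      congr 1
      funext a
      split_ifs <;> simp
    · rw [← Matrix.diagonal_zero]
      congr 1
      funext a
      split_ifs <;> simp_all
  · ext a b
    rw [Matrix.sum_apply]
    simp only [matIdem, Matrix.diagonal_apply, Matrix.one_apply]
    split_ifs with h
    · rw [Finset.sum_ite_eq, if_pos (hX a)]
    · simp
  · rw [matE_mul_matF, matF_mul_matE, Matrix.diagonal_sub]
    ext a b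
    rw [Matrix.sum_apply]
    simp only [matIdem, Matrix.diagonal_apply, Matrix.smul_apply, smul_eq_mul, mul_ite, mul_one,
      mul_zero]
    split_ifs with h
    · rw [Finset.sum_ite_eq, if_pos (hX a), mul_comm, mul_comm (qNat v a), qNat_mul_sub hv]
      have := a.2
      congr 1
      lia
    · simp
  · ext a b
    rw [matIdem, matIdem, Matrix.mul_diagonal, Matrix.diagonal_mul]
    by_cases h : (b : ℕ) = a + 1
    · have h' : ((m : ℤ) - 2 * (b : ℕ) = i) ↔ ((m : ℤ) - 2 * (a : ℕ) = i + 2) := by lia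
      simp only [h', mul_comm (matE v m a b)]
    · simp [matE, h]
  · ext a b
    rw [matIdem, matIdem, Matrix.mul_diagonal, Matrix.diagonal_mul]
    by_cases h : (a : ℕ) = b + 1
    · have h' : ((m : ℤ) - 2 * (b : ℕ) = i) ↔ ((m : ℤ) - 2 * (a : ℕ) = i - 2) := by lia
      simp only [h', mul_comm (matF v m a b)]
    · simp [matF, h]

/-- The representation of `S(n)` on the simple module of highest weight `m`. -/
noncomputable def rep (hv : v ≠ 0) {n : ℤ} {m : ℕ} (hm : (m : ℤ) ∈ X n) :
    SchurAlg v n →ₐ[k] Matrix (Fin (m + 1)) (Fin (m + 1)) k :=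
  (isSchurFamily_mat hv hm).lift

theorem matF_pow_apply_zero (m a : ℕ) (i : Fin (m + 1)) :
    (matF v m ^ a) i 0 = if (i : ℕ) = a then qFactorial v a else 0 := by
  induction a generalizing i with
  | zero =>
    rw [pow_zero, Matrix.one_apply, qFactorial_zero]
    exact if_congr Fin.ext_iff rfl rfl
  | succ a ih =>
    rw [pow_succ', Matrix.mul_apply]
    simp only [ih]
    by_cases h : (i : ℕ) = a + 1
    · rw [Finset.sum_eq_single ⟨a, by lia⟩]
      · simp [matF, h, qFactorial_succ, mul_comm]
      · intro l _ hl
        have : (l : ℕ) ≠ a := fun h => hl (Fin.ext h)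
        simp [this]
      · simp
    · rw [if_neg h]
      refine Finset.sum_eq_zero fun l _ => ?_
      by_cases hl : (l : ℕ) = a
      · simp [matF, hl, h]
      · simp [hl]

theorem matE_pow_zero_apply (m b : ℕ) (j : Fin (m + 1)) :
    (matE v m ^ b) 0 j =
      if (j : ℕ) = b then ∏ l ∈ Finset.range b, qNat v (m - l) else 0 := by
  induction b generalizing j with
  | zero =>
    rw [pow_zero, Matrix.one_apply]
    exact if_congr (eq_comm.trans Fin.ext_iff) (by simp) rfl
  | succ b ih =>
    rw [pow_succ, Matrix.mul_apply]
    simp only [ih]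
    by_cases h : (j : ℕ) = b + 1
    · rw [Finset.sum_eq_single ⟨b, by lia⟩]
      · simp [matE, h, Finset.prod_range_succ]
      · intro l _ hl
        have : (l : ℕ) ≠ b := fun h => hl (Fin.ext h)
        simp [this]
      · simp
    · rw [if_neg h]
      refine Finset.sum_eq_zero fun l _ => ?_
      by_cases hl : (l : ℕ) = b
      · simp [matE, hl, h]
      · simp [hl]

theorem matIdem_self (m : ℕ) : matIdem k m m = Matrix.single 0 0 1 := by
  ext i j
  rw [matIdem, Matrix.diagonal_apply, Matrix.single_apply]
  by_cases h : i = j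
  · subst h
    by_cases h0 : i = 0
    · simp [h0]
    · have : (i : ℕ) ≠ 0 := fun h => h0 (Fin.ext h)
      simp [this, Ne.symm h0]
  · rw [if_neg h, if_neg (by rintro ⟨rfl, rfl⟩; exact h rfl)]

/-- As $1_m$ acts as $e_{00}$, the product is column $0$ of $F^{(a)}$ times row $0$ of $E^{(b)}$,
each with one nonzero entry. The column entry is $1$, so the scalar depends on $b$ alone. -/
theorem rep_monomial (hv : v ≠ 0) {n : ℤ} {m : ℕ} (hm : (m : ℤ) ∈ X n)
    (hq : qFactorial v m ≠ 0) (b : Fin (m + 1)) :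
    ∃ c : k, c ≠ 0 ∧ ∀ a : Fin (m + 1),
      rep hv hm (monomial v n m a b) = Matrix.single a b c := by
  refine ⟨(qFactorial v b)⁻¹ * ∏ l ∈ Finset.range b, qNat v (m - l),
    mul_ne_zero (inv_ne_zero (qFactorial_ne_zero hq (by lia)))
      (Finset.prod_ne_zero_iff.mpr fun l hl => ?_), fun a => ?_⟩
  · have := Finset.mem_range.mp hl
    exact qNat_ne_zero hq (by lia) (by lia)
  have ha : qFactorial v a ≠ 0 := qFactorial_ne_zero hq (by lia)
  rw [monomial_eq_smul, map_smul, map_mul, map_mul, map_pow, map_pow, rep, IsSchurFamily.lift_E,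
    IsSchurFamily.lift_F, IsSchurFamily.lift_idem, matIdem_self]
  ext i j
  rw [Matrix.smul_apply, Matrix.mul_apply, Finset.sum_eq_single 0]
  · rw [Matrix.mul_single_apply_same, matF_pow_apply_zero, matE_pow_zero_apply,
      Matrix.single_apply]
    by_cases h1 : a = i
    · by_cases h2 : b = j
      · simp only [h1, h2, and_self, if_true, smul_eq_mul, mul_one]
        rw [h1] at ha
        field_simp
      · have : (j : ℕ) ≠ b := fun h => h2 (Fin.ext h.symm)
        simp [h2, this]
    · have : (i : ℕ) ≠ a := fun h => h1 (Fin.ext h.symm)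
      simp [h1, this]
  · intro l _ hl
    rw [Matrix.mul_single_apply_of_ne _ _ _ _ _ hl, zero_mul]
  · simp

theorem rep_monomial_of_lt (hv : v ≠ 0) {n : ℤ} {m : ℕ} (hm : (m : ℤ) ∈ X n) {m' : ℤ}
    (h : (m : ℤ) < m') (a b : ℕ) : rep hv hm (monomial v n m' a b) = 0 := by
  have h0 : rep hv hm (idem v n m') = 0 := by
    rw [rep, IsSchurFamily.lift_idem]
    -- The same matrices form a family for $S(m)$, where the weight $m'$ does not occur.
    exact (isSchurFamily_mat hv (n := m) (by rw [mem_X]; lia)).eq_zero _ (notMem_X_of_lt h)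
  rw [monomial, map_mul, map_mul, h0, mul_zero, zero_mul]

theorem toNat_mem_X {n m : ℤ} (hm : m ∈ Xplus n) : (m.toNat : ℤ) ∈ X n := by
  rw [mem_Xplus] at hm
  rw [mem_X]
  lia

theorem qFactorial_toNat_ne_zero {n m : ℤ} (hn : qFactorial v n.toNat ≠ 0) (hm : m ∈ Xplus n) :
    qFactorial v m.toNat ≠ 0 := by
  rw [mem_Xplus] at hm
  exact qFactorial_ne_zero hn (by lia)

/-- The product of the representations of `S(n)` with highest weight in `X(n)_+`. -/
noncomputable def totalRep (hv : v ≠ 0) (n : ℤ) :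
    SchurAlg v n →ₐ[k]
      ((m : Xplus n) → Matrix (Fin ((m : ℤ).toNat + 1)) (Fin ((m : ℤ).toNat + 1)) k) :=
  AlgHom.pi fun m => rep hv (toNat_mem_X m.2)

theorem totalRep_apply (hv : v ≠ 0) (n : ℤ) (x : SchurAlg v n) (m : Xplus n) :
    totalRep hv n x m = rep hv (toNat_mem_X m.2) x := rfl

/-- Block triangular in $m$: in entry $(a,b)$ of block $m$, terms with larger weight vanish, terms
with smaller weight have zero coefficient by induction, and only one term of weight $m$ remains. -/
theorem linearIndependent_totalRep (hv : v ≠ 0) (n : ℤ) (hn : qFactorial v n.toNat ≠ 0) :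
    LinearIndependent k fun s => totalRep hv n (monomialFamily v n s) := by
  rw [Fintype.linearIndependent_iff]
  intro g hg
  suffices h : ∀ (N : ℕ) (s : (m : Xplus n) × Fin ((m : ℤ).toNat + 1) × Fin ((m : ℤ).toNat + 1)),
      (s.1 : ℤ).toNat = N → g s = 0 from fun s => h _ s rfl
  intro N
  induction N using Nat.strong_induction_on with
  | _ N ih =>
    rintro ⟨⟨m, hm⟩, a, b⟩ hN
    change m.toNat = N at hN
    have hm0 := (mem_Xplus.mp hm).1.2
    have hmm : ((m.toNat : ℕ) : ℤ) = m := Int.toNat_of_nonneg hm0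
    obtain ⟨c, hc, hrep⟩ := rep_monomial hv (toNat_mem_X hm) (qFactorial_toNat_ne_zero hn hm) b
    have h1 := congrFun (congrFun (congrFun hg ⟨m, hm⟩) a) b
    rw [Finset.sum_apply, Matrix.sum_apply, Finset.sum_eq_single ⟨⟨m, hm⟩, a, b⟩] at h1
    · change g _ * rep hv (toNat_mem_X hm) (monomial v n m a b) a b = 0 at h1
      rw [hmm] at hrep
      rw [hrep a, Matrix.single_apply_same] at h1
      exact (mul_eq_zero.mp h1).resolve_right hc
    · rintro ⟨⟨m', hm'⟩, a', b'⟩ - hne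
      change g _ * rep hv (toNat_mem_X hm) (monomial v n m' a' b') a b = 0
      have hm0' := (mem_Xplus.mp hm').1.2
      rcases lt_trichotomy m' m with h | rfl | h
      · rw [ih m'.toNat (by lia) ⟨⟨m', hm'⟩, a', b'⟩ rfl, zero_mul]
      · obtain ⟨c', -, hrep'⟩ :=
          rep_monomial hv (toNat_mem_X hm) (qFactorial_toNat_ne_zero hn hm) b'
        rw [hmm] at hrep'
        rw [hrep' a', Matrix.single_apply, if_neg, mul_zero]
        rintro ⟨rfl, rfl⟩
        exact hne rfl
      · rw [rep_monomial_of_lt hv _ (by lia), Matrix.zero_apply, mul_zero]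
    · simp

/-- The basis `F^{(a)} 1_m E^{(b)}` of `S(n)`. -/
noncomputable def monomialBasis (hv : v ≠ 0) (n : ℤ) (hn : qFactorial v n.toNat ≠ 0) :
    Module.Basis ((m : Xplus n) × Fin ((m : ℤ).toNat + 1) × Fin ((m : ℤ).toNat + 1))
      k (SchurAlg v n) :=
  Module.Basis.mk
    (LinearIndependent.of_comp (totalRep hv n).toLinearMap (linearIndependent_totalRep hv n hn))
    (span_monomialFamily hv n hn).ge

theorem monomialBasis_apply (hv : v ≠ 0) (n : ℤ) (hn : qFactorial v n.toNat ≠ 0)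
    (s : (m : Xplus n) × Fin ((m : ℤ).toNat + 1) × Fin ((m : ℤ).toNat + 1)) :
    monomialBasis hv n hn s = monomialFamily v n s :=
  Module.Basis.mk_apply _ _ s

theorem finrank_eq (hv : v ≠ 0) (n : ℤ) (hn : qFactorial v n.toNat ≠ 0) :
    Module.finrank k (SchurAlg v n) = ∑ m ∈ Xplus n, (m.toNat + 1) ^ 2 := by
  rw [Module.finrank_eq_card_basis (monomialBasis hv n hn), Fintype.card_sigma,
    ← Finset.sum_coe_sort (Xplus n)]
  simp [sq]

theorem totalRep_bijective (hv : v ≠ 0) (n : ℤ) (hn : qFactorial v n.toNat ≠ 0) :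
    Function.Bijective (totalRep hv n) := by
  have := Module.Finite.of_basis (monomialBasis hv n hn)
  have hr : Module.finrank k
      ((m : Xplus n) → Matrix (Fin ((m : ℤ).toNat + 1)) (Fin ((m : ℤ).toNat + 1)) k) =
      Fintype.card ((m : Xplus n) × Fin ((m : ℤ).toNat + 1) × Fin ((m : ℤ).toNat + 1)) := by
    rw [Module.finrank_pi_fintype, Fintype.card_sigma]
    simp [Module.finrank_matrix]
  have hs : Function.Surjective (totalRep hv n).toLinearMap := by
    rw [← LinearMap.range_eq_top]
    refine top_unique ?_
    rw [← (linearIndependent_totalRep hv n hn).span_eq_top_of_card_eq_finrank' hr.symm,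
      Submodule.span_le]
    rintro _ ⟨s, rfl⟩
    exact ⟨_, rfl⟩
  refine ⟨(LinearMap.injective_iff_surjective_of_finrank_eq_finrank ?_).mpr hs, hs⟩
  rw [hr, Module.finrank_eq_card_basis (monomialBasis hv n hn)]

theorem isSplitSemisimple (hv : v ≠ 0) (n : ℤ) (hn : qFactorial v n.toNat ≠ 0) :
    IsSplitSemisimple k (SchurAlg v n) := by
  let e := (Xplus n).equivFin.symm
  refine ⟨(Xplus n).card, fun i => (e i : ℤ).toNat + 1, fun i => Nat.succ_pos _, ⟨?_⟩⟩
  exact (AlgEquiv.ofBijective (totalRep hv n) (totalRep_bijective hv n hn)).trans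
    (AlgEquiv.piCongrLeft k (fun m : Xplus n =>
      Matrix (Fin ((m : ℤ).toNat + 1)) (Fin ((m : ℤ).toNat + 1)) k) e).symm

theorem linearIndependent_monomial {n : ℕ} (hv : v ≠ 0) (hn : qFactorial v n ≠ 0) :
    LinearIndependent k fun p : Fin (n + 1) × Fin (n + 1) => monomial v n n p.1 p.2 := by
  have hm : (n : ℤ) ∈ Xplus (n : ℤ) := by
    rw [mem_Xplus]
    lia
  have h := (monomialBasis hv n hn).linearIndependent.comp
    (fun p : Fin (n + 1) × Fin (n + 1) => ⟨⟨n, hm⟩, p⟩) (fun p q hpq => by simpa using hpq)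
  convert h using 1
  funext p
  exact (monomialBasis_apply hv n hn ⟨⟨n, hm⟩, p⟩).symm

theorem sum_sq_eq_choose (n : ℕ) :
    ∑ m ∈ Xplus n, (m.toNat + 1) ^ 2 = (n + 3).choose 3 := by
  induction n using Nat.twoStepInduction with
  | zero => decide +kernel
  | one => decide +kernel
  | more n ih _ =>
    have h : Xplus ((n + 2 : ℕ) : ℤ) = insert ((n + 2 : ℕ) : ℤ) (Xplus n) := by
      ext i
      rw [Finset.mem_insert, mem_Xplus, mem_Xplus]
      lia
    have h' : ((n + 2 : ℕ) : ℤ) ∉ Xplus (n : ℤ) := by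
      rw [mem_Xplus]
      lia
    rw [h, Finset.sum_insert h', ih, Int.toNat_natCast]
    -- Pascal's rule leaves two consecutive triangular numbers, whose sum is $(n+3)^2$.
    have h1 : (n + 2 + 3).choose 3 = (n + 3).choose 3 + (n + 3).choose 2 + (n + 4).choose 2 := by
      rw [show n + 2 + 3 = (n + 4) + 1 by ring, Nat.choose_succ_succ' (n + 4) 2,
        Nat.choose_succ_succ' (n + 3) 2]
      ring
    have h2 : (n + 4).choose 2 = (n + 3) + (n + 3).choose 2 := by
      rw [Nat.choose_succ_succ' (n + 3) 1, Nat.choose_one_right]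
    have h3 : (n + 3).choose 2 * 2 = (n + 3) * (n + 2) := by
      rw [Nat.choose_two_right, Nat.div_mul_cancel (Nat.even_mul_pred_self _).two_dvd]
      rfl
    rw [h1, h2]
    nlinarith

end Representation

/-! ### Classification of the simple modules -/

section SimpleModules

variable {k : Type*} [Field k] {v : k}

theorem rep_idem_self (hv : v ≠ 0) {n m : ℤ} (hm : m ∈ Xplus n) :
    rep hv (toNat_mem_X hm) (idem v n m) = Matrix.single 0 0 1 := by
  rw [rep, IsSchurFamily.lift_idem, ← matIdem_self, Int.toNat_of_nonneg (mem_Xplus.mp hm).1.2]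

theorem rep_idem_of_lt (hv : v ≠ 0) {n m m' : ℤ} (hm' : m' ∈ Xplus n) (h : m' < m) :
    rep hv (toNat_mem_X hm') (idem v n m) = 0 := by
  have h1 := rep_monomial_of_lt hv (toNat_mem_X hm') (m' := m)
    (by have := (mem_Xplus.mp hm').1.2; lia) 0 0
  simpa [monomial, divE, divF, qFactorial_zero] using h1

theorem rep_comp_proj (hv : v ≠ 0) {n l : ℤ} (hX : X l ⊆ X n) {m : ℕ} (hl : (m : ℤ) ∈ X l)
    (hn : (m : ℤ) ∈ X n) (x : SchurAlg v n) : rep hv hl (proj v hX x) = rep hv hn x := by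
  have h : (rep hv hl).comp (proj v hX) = rep hv hn := by
    apply algHom_ext <;> intros <;>
      simp only [AlgHom.comp_apply, proj_E, proj_F, proj_idem, rep, IsSchurFamily.lift_E,
        IsSchurFamily.lift_F, IsSchurFamily.lift_idem]
  exact DFunLike.congr_fun h x

theorem self_mem_Xplus {m : ℤ} (h : 0 ≤ m) : m ∈ Xplus m := by
  rw [mem_Xplus]
  lia

/-- Equality in `S(m)` of elements `1_m`-invariant on one side can be checked in the
representation of highest weight `m`. -/
theorem eq_of_rep_eq (hv : v ≠ 0) {m : ℤ} (h0 : 0 ≤ m) (hq : qFactorial v m.toNat ≠ 0)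
    {x y : SchurAlg v m} (hx : x * idem v m m = x) (hy : y * idem v m m = y)
    (h : rep hv (toNat_mem_X (self_mem_Xplus h0)) x =
      rep hv (toNat_mem_X (self_mem_Xplus h0)) y) : x = y := by
  apply (totalRep_bijective hv m hq).1
  funext ⟨m', hm'⟩
  rw [totalRep_apply, totalRep_apply]
  rcases eq_or_ne m' m with rfl | hne
  · exact h
  · have hlt : m' < m := lt_of_le_of_ne (mem_Xplus.mp hm').1.1 hne
    rw [← hx, ← hy, map_mul, map_mul, rep_idem_of_lt hv hm' hlt, mul_zero, mul_zero]

/-- This gives the simplicity of $V(m)$: in block $m$ such a $y$ is a matrix supported in column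
$0$, and $1_mE^{(a)}$, a multiple of $e_{0a}$, moves a nonzero entry $(a,0)$ to the corner. -/
theorem exists_mul_eq_smul_idem (hv : v ≠ 0) {m : ℤ} (h0 : 0 ≤ m)
    (hq : qFactorial v m.toNat ≠ 0) {y : SchurAlg v m} (hy : y * idem v m m = y) (hy0 : y ≠ 0) :
    ∃ (a : ℕ) (c : k), c ≠ 0 ∧ monomial v m m 0 a * y = c • idem v m m := by
  have hm := self_mem_Xplus h0
  have hyr : rep hv (toNat_mem_X hm) y ≠ 0 := fun h =>
    hy0 (eq_of_rep_eq hv h0 hq hy (zero_mul _) (by rw [h, map_zero]))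
  have hry : rep hv (toNat_mem_X hm) y * Matrix.single 0 0 1 = rep hv (toNat_mem_X hm) y := by
    rw [← rep_idem_self hv hm, ← map_mul, hy]
  obtain ⟨a, ha⟩ : ∃ a, rep hv (toNat_mem_X hm) y a 0 ≠ 0 := by
    by_contra! hcon
    apply hyr
    ext a j
    rw [← hry]
    by_cases hj : j = 0
    · rw [hj, Matrix.mul_single_apply_same, hcon, zero_mul, Matrix.zero_apply]
    · rw [Matrix.mul_single_apply_of_ne _ _ _ _ _ hj, Matrix.zero_apply]
  obtain ⟨c, hc, hrep⟩ := rep_monomial hv (toNat_mem_X hm) hq a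
  have hrep0 := hrep 0
  rw [Int.toNat_of_nonneg h0] at hrep0
  refine ⟨a, c * rep hv (toNat_mem_X hm) y a 0, mul_ne_zero hc ha, ?_⟩
  apply eq_of_rep_eq hv h0 hq
  · rw [mul_assoc, hy]
  · rw [smul_mul_assoc, idem_mul_idem, if_pos rfl]
  · rw [map_mul, map_smul, rep_idem_self hv hm]
    rw [Fin.val_zero] at hrep0
    rw [hrep0, ← hry]
    ext i j
    by_cases hj : j = 0
    · subst hj
      by_cases hi : i = 0
      · subst hi
        simp
      · simp [hi, Ne.symm hi]
    · rw [← Matrix.mul_assoc, Matrix.mul_single_apply_of_ne _ _ _ _ _ hj, Matrix.smul_apply,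
        Matrix.single_apply, if_neg (fun h => hj h.2.symm), smul_zero]

variable {n : ℤ}

theorem V_smul_val (m : Xplus n) (s : SchurAlg v n) (y : V v n m) :
    (s • y).1 = proj v (X_subset_of_mem m.2) s * y.1 := rfl

/-- The generator `1_m` of `V(m)`. -/
noncomputable def V.gen (v : k) (n : ℤ) (m : Xplus n) : V v n m :=
  ⟨idem v m m, Ideal.mem_span_singleton_self _⟩

theorem V_val_mul_idem (m : Xplus n) (y : V v n m) : y.1 * idem v m m = y.1 := by
  obtain ⟨y, hy⟩ := y
  obtain ⟨s, rfl⟩ := Ideal.mem_span_singleton'.mp hy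
  rw [mul_assoc, idem_mul_idem, if_pos rfl]

theorem idem_self_ne_zero (hv : v ≠ 0) {m : ℤ} (h0 : 0 ≤ m) : idem v m m ≠ 0 := by
  intro h
  have h1 := rep_idem_self hv (self_mem_Xplus h0)
  rw [h, map_zero] at h1
  simpa using congrFun (congrFun h1 0) 0

theorem V.gen_ne_zero (hv : v ≠ 0) (m : Xplus n) : V.gen v n m ≠ 0 := fun h =>
  idem_self_ne_zero hv (mem_Xplus.mp m.2).1.2 (congrArg Subtype.val h)

theorem V.exists_smul_gen (m : Xplus n) (y : V v n m) : ∃ s : SchurAlg v n, s • V.gen v n m = y := by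
  obtain ⟨s, hs⟩ := proj_surjective v (X_subset_of_mem m.2) y.1
  exact ⟨s, Subtype.ext (by rw [V_smul_val, hs]; exact V_val_mul_idem m y)⟩

theorem isSimpleModule_V (hv : v ≠ 0) (hn : qFactorial v n.toNat ≠ 0) (m : Xplus n) :
    IsSimpleModule (SchurAlg v n) (V v n m) := by
  rw [isSimpleModule_iff_toSpanSingleton_surjective]
  refine ⟨⟨⟨V.gen v n m, 0, V.gen_ne_zero hv m⟩⟩, fun y hy z => ?_⟩
  have hy0 : y.1 ≠ 0 := fun h => hy (Subtype.ext h)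
  obtain ⟨a, c, hc, h⟩ := exists_mul_eq_smul_idem hv (mem_Xplus.mp m.2).1.2
    (qFactorial_toNat_ne_zero hn m.2) (V_val_mul_idem m y) hy0
  obtain ⟨s, hs⟩ := V.exists_smul_gen m z
  refine ⟨s * (c⁻¹ • monomial v n m 0 a), ?_⟩
  rw [LinearMap.toSpanSingleton_apply, mul_smul, ← hs]
  congr 1
  apply Subtype.ext
  rw [V_smul_val, map_smul, proj_monomial, smul_mul_assoc, h, inv_smul_smul₀ hc]
  rfl

/-- The highest weight is an invariant: $1_{m'}$ fixes the generator of $V(m')$ but kills $V(m)$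
when $m<m'$. -/
theorem eq_of_V_equiv (hv : v ≠ 0) (m m' : Xplus n)
    (h : Nonempty (V v n m ≃ₗ[SchurAlg v n] V v n m')) : m = m' := by
  have key : ∀ m m' : Xplus n, Nonempty (V v n m ≃ₗ[SchurAlg v n] V v n m') →
      (m' : ℤ) ≤ m := by
    rintro m m' ⟨e⟩
    by_contra! hlt
    apply V.gen_ne_zero hv m'
    have h1 : idem v n m' • V.gen v n m' = V.gen v n m' := by
      apply Subtype.ext
      rw [V_smul_val, proj_idem]
      exact V_val_mul_idem m' (V.gen v n m')
    rw [← h1, ← e.apply_symm_apply (V.gen v n m'), ← map_smul, LinearEquiv.map_eq_zero_iff]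
    apply Subtype.ext
    rw [V_smul_val, proj_idem, idem_of_notMem v (notMem_X_of_lt hlt), zero_mul]
    rfl
  exact Subtype.ext (le_antisymm (key m' m ⟨h.some.symm⟩) (key m m' h))

/-- An element of `S(n)` that acts as a matrix unit in the representation of highest weight `m`,
and as zero in the others. -/
theorem exists_matrixUnit (hv : v ≠ 0) (hn : qFactorial v n.toNat ≠ 0) :
    ∃ u : (m : Xplus n) → Fin ((m : ℤ).toNat + 1) → Fin ((m : ℤ).toNat + 1) → SchurAlg v n,
      ∀ m a b, totalRep hv n (u m a b) = Pi.single m (Matrix.single a b 1) := by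
  choose g hg using (totalRep_bijective hv n hn).2
  exact ⟨fun m a b => g _, fun m a b => hg _⟩

theorem exists_equiv_V (hv : v ≠ 0) (hn : qFactorial v n.toNat ≠ 0) (M : Type*) [AddCommGroup M]
    [Module (SchurAlg v n) M] [IsSimpleModule (SchurAlg v n) M] :
    ∃ m : Xplus n, Nonempty (M ≃ₗ[SchurAlg v n] V v n m) := by
  obtain ⟨u, hu⟩ := exists_matrixUnit hv hn
  have hinj := (totalRep_bijective hv n hn).1
  -- The corner idempotents generate the unit ideal, so one of them acts nontrivially on $M$.
  have hsum : ∑ m : Xplus n, ∑ a, u m a 0 * u m 0 0 * u m 0 a = 1 := by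
    apply hinj
    rw [map_sum, map_one, ← Finset.univ_sum_single (1 : (m : Xplus n) →
      Matrix (Fin ((m : ℤ).toNat + 1)) (Fin ((m : ℤ).toNat + 1)) k)]
    refine Finset.sum_congr rfl fun m _ => ?_
    rw [Pi.one_apply, ← Matrix.diagonal_one, ← Matrix.sum_single_eq_diagonal, map_sum]
    simp only [map_mul, hu, ← Pi.single_mul, Matrix.single_mul_single_same, mul_one]
    exact (map_sum (AddMonoidHom.single (fun m : Xplus n =>
      Matrix (Fin ((m : ℤ).toNat + 1)) (Fin ((m : ℤ).toNat + 1)) k) m) _ _).symm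
  obtain ⟨m, y, hy⟩ : ∃ (m : Xplus n) (y : M), u m 0 0 • y ≠ 0 := by
    by_contra! hcon
    have := IsSimpleModule.nontrivial (SchurAlg v n) M
    obtain ⟨z, hz⟩ := exists_ne (0 : M)
    apply hz
    rw [← one_smul (SchurAlg v n) z, ← hsum, Finset.sum_smul]
    refine Finset.sum_eq_zero fun m _ => ?_
    rw [Finset.sum_smul]
    refine Finset.sum_eq_zero fun a _ => ?_
    rw [mul_smul, mul_smul, hcon, smul_zero]
  have hV := isSimpleModule_V hv hn m
  let f := LinearMap.toSpanSingleton (SchurAlg v n) M (u m 0 0 • y)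
  let g := LinearMap.toSpanSingleton (SchurAlg v n) (V v n m) (V.gen v n m)
  have hf : Function.Surjective f := IsSimpleModule.toSpanSingleton_surjective _ hy
  have hg : Function.Surjective g :=
    IsSimpleModule.toSpanSingleton_surjective _ (V.gen_ne_zero hv m)
  -- If $s1_m=0$ in $S(m)$, then $s\,e_{00}=0$ in block $m$, so $s$ kills the corner unit in $S(n)$.
  -- Both kernels are maximal left ideals, so this inclusion is an equality.
  have hle : LinearMap.ker g ≤ LinearMap.ker f := by
    intro s hs
    have hs' : proj v (X_subset_of_mem m.2) s * idem v m m = 0 := congrArg Subtype.val hs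
    have h0 := (mem_Xplus.mp m.2).1.2
    have hsu : s * u m 0 0 = 0 := by
      apply hinj
      rw [map_mul, hu, map_zero]
      funext m'
      rcases eq_or_ne m' m with rfl | hne
      · have h1 := congrArg (rep hv (toNat_mem_X (self_mem_Xplus h0))) hs'
        rw [map_mul, rep_idem_self hv (self_mem_Xplus h0), map_zero, rep_comp_proj hv _ _ (toNat_mem_X m'.2)] at h1
        rw [Pi.mul_apply, Pi.single_eq_same]
        exact h1
      · rw [Pi.mul_apply, Pi.single_eq_of_ne hne, mul_zero, Pi.zero_apply]
    rw [LinearMap.mem_ker, LinearMap.toSpanSingleton_apply, ← mul_smul, hsu, zero_smul]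
  have hker : LinearMap.ker g = LinearMap.ker f :=
    ((LinearMap.isCoatom_ker_of_surjective hg).le_iff.mp hle).elim
      (fun h => absurd h (LinearMap.isCoatom_ker_of_surjective hf).1) Eq.symm
  exact ⟨m, ⟨(f.quotKerEquivOfSurjective hf).symm.trans
    ((Submodule.quotEquivOfEq _ _ hker.symm).trans (g.quotKerEquivOfSurjective hg))⟩⟩

end SimpleModules

end QSchur

theorem theoremt {k : Type*} [Field k] (v : k) (hv : v ≠ 0) (n : ℕ)
    (hn : QSchur.qFactorial v n ≠ 0) :
    -- (a) a basis of the two-sided ideal generated by `1_n`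
    (LinearIndependent k (fun p : Fin (n + 1) × Fin (n + 1) =>
        QSchur.divF v n p.1 * QSchur.idem v n n * QSchur.divE v n p.2) ∧
      (Submodule.span k (Set.range (fun p : Fin (n + 1) × Fin (n + 1) =>
          QSchur.divF v n p.1 * QSchur.idem v n n * QSchur.divE v n p.2)) :
            Set (QSchur.SchurAlg v n)) =
        (TwoSidedIdeal.span {QSchur.idem v n n} : Set (QSchur.SchurAlg v n))) ∧
    -- (b) the exact sequence, and the induced isomorphism from the quotient
    (Function.Surjective (QSchur.proj v (QSchur.X_sub_two_subset n)) ∧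
      TwoSidedIdeal.ker (QSchur.proj v (QSchur.X_sub_two_subset n)) =
        TwoSidedIdeal.span {QSchur.idem v n n} ∧
      ∃ e : (TwoSidedIdeal.span {QSchur.idem v (n : ℤ) n}).ringCon.Quotient ≃ₐ[k]
          QSchur.SchurAlg v ((n : ℤ) - 2),
        ∀ x : QSchur.SchurAlg v n,
          e (x : (TwoSidedIdeal.span {QSchur.idem v (n : ℤ) n}).ringCon.Quotient) =
            QSchur.proj v (QSchur.X_sub_two_subset n) x) ∧
    -- (c) split semisimplicity, and the complete set of simple modules
    (QSchur.IsSplitSemisimple k (QSchur.SchurAlg v n) ∧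
      (∀ m : QSchur.Xplus n, IsSimpleModule (QSchur.SchurAlg v n) (QSchur.V v n m)) ∧
      (∀ m m' : QSchur.Xplus n,
        Nonempty (QSchur.V v n m ≃ₗ[QSchur.SchurAlg v n] QSchur.V v n m') → m = m') ∧
      (∀ (M : Type*) [AddCommGroup M] [Module (QSchur.SchurAlg v n) M]
        [IsSimpleModule (QSchur.SchurAlg v n) M],
        ∃ m : QSchur.Xplus n,
          Nonempty (M ≃ₗ[QSchur.SchurAlg v n] QSchur.V v n m))) ∧
    -- (d) a basis of `S(n)`
    (∃ b : Module.Basis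
        ((m : QSchur.Xplus n) × Fin ((m : ℤ).toNat + 1) × Fin ((m : ℤ).toNat + 1))
        k (QSchur.SchurAlg v n),
      ∀ (m : QSchur.Xplus n) (i j : Fin ((m : ℤ).toNat + 1)),
        b ⟨m, i, j⟩ = QSchur.divF v n i * QSchur.idem v n m * QSchur.divE v n j) ∧
    -- (e) the dimension
    (Module.finrank k (QSchur.SchurAlg v n) =
        ∑ m ∈ QSchur.Xplus n, (m.toNat + 1) ^ 2 ∧
      ∑ m ∈ QSchur.Xplus n, (m.toNat + 1) ^ 2 = (n + 3).choose 3) := by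
  exact ⟨⟨QSchur.linearIndependent_monomial hv hn, QSchur.span_monomial_eq hv hn⟩,
    ⟨QSchur.proj_surjective v _, QSchur.ker_proj hv hn, QSchur.exists_quotient_algEquiv hv hn⟩,
    ⟨QSchur.isSplitSemisimple hv n hn, QSchur.isSimpleModule_V hv hn, QSchur.eq_of_V_equiv hv,
      fun M _ _ _ => QSchur.exists_equiv_V (n := (n : ℤ)) hv hn M⟩,
    ⟨QSchur.monomialBasis hv n hn, fun m i j => QSchur.monomialBasis_apply hv n hn ⟨m, i, j⟩⟩,
    QSchur.finrank_eq hv n hn, QSchur.sum_sq_eq_choose n⟩
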